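/- Let $N\ge 2$ be an integer, $\omega^{x}:=e^{2\pi i x/N}$ for $x\in\mathbb C$, and let $\log$ be the principal logarithm ($\operatorname{Im}\log\in(-\pi,\pi]$). For $b=\sqrt N$ and $c_b=\frac i2(b+b^{-1})$, let $\Phi_b$ be Faddeev's noncompact quantum dilogarithm, i.e. the meromorphic function on $\mathbb C$ which for $|\operatorname{Im} z|<|\operatorname{Im} c_b|$ is given by $$\Phi_b(z)=\exp\int_{\mathbb R+i\varepsilon}\frac{e^{-2izw}}{4\sinh(wb)\sinh(w/b)}\,\frac{dw}{w},$$ where $0<\varepsilon<\pi/\sqrt N$ (the choice of $\varepsilon$ is immaterial). Put $$\varphi_N(\zeta)=\Phi_{\sqrt N}\Bigl(\tfrac{i\zeta}{\sqrt N}-c_{\sqrt N}+\tfrac{i}{\sqrt N}\Bigr),\qquad D(\zeta)=\exp\Bigl(\frac1N\sum_{k=1}^{N-1}k\log(1-\omega^{\zeta+k})\Bigr).$$ Let $\zeta^0,\zeta^1\in\mathbb C$ satisfy $e^{2\pi i\zeta^1}=1/(1-e^{2\pi i\zeta^0})$, and define, for $n\in\mathbb Z$, $$\Lambda(\zeta^0,\zeta^1|n)=\omega^{-\zeta^0\zeta^1/2}\,\omega^{-n\zeta^1}\,\varphi_N(\zeta^0+n),$$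 $$\mathcal L(\zeta^0,\zeta^1)=\operatorname{Li}_2(e^{2\pi i\zeta^0})+\frac{(2\pi i)^2}{2}\zeta^0\zeta^1+2\pi i\,\zeta^0\log(1-e^{2\pi i\zeta^0}),\qquad \operatorname{Li}_2(z)=\int_0^z-\frac{\log(1-t)}{t}\,dt,$$ the integral being taken along the straight segment from $0$ to $z$. Let $\widehat v_0,\dots,\widehat v_{N-1}$ be a basis of $\mathbb C^N$ and let $\mathcal Z:\mathbb C^N\to\mathbb C^N$ be the linear map with $$\mathcal Z(\widehat v_n)=\sum_{n'=0}^{N-1}\Lambda(\zeta^0,\zeta^1|n'-n)\,\widehat v_{n'}\qquad(0\le n<N).$$ Then $$\det\mathcal Z=\frac{N^N}{D(0)^N}\;\omega^{N(N-1)\zeta^0/2}\;\exp\Bigl(-\frac{\mathcal L(\zeta^0,\zeta^1)}{2\pi i}\Bigr).$$ -/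

import Mathlib

noncomputable section

namespace QuantumDilog

open Complex

/-- `ω ^ x = exp (2 π i x / N)` for complex `x`, where `ω = exp (2 π i / N)`. -/
def omegaPow (N : ℕ) (x : ℂ) : ℂ := exp (2 * Real.pi * I * x / N)

/-- `c_b = (i / 2) (b + b⁻¹)`. -/
def cConst (b : ℂ) : ℂ := I / 2 * (b + b⁻¹)

/-- The strip `|Im z| < |Im c_b|` on which Faddeev's integral converges. -/
def strip (b : ℂ) : Set ℂ := {z | |z.im| < |(cConst b).im|}

/-- Faddeev's integral formula
`exp ∫_{ℝ + iε} exp (-2 i z w) / (4 sinh (w b) sinh (w / b)) dw / w`. -/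
def faddeevIntegral (ε : ℝ) (b z : ℂ) : ℂ :=
  exp (∫ t : ℝ,
    exp (-2 * I * z * ((t : ℂ) + I * ε)) /
      (4 * sinh (((t : ℂ) + I * ε) * b) * sinh (((t : ℂ) + I * ε) / b)) /
      ((t : ℂ) + I * ε))

open Classical in
/-- The meromorphic continuation to the whole plane of a function `f` given on `U`: the
meromorphic function on `ℂ` (in normal form, i.e. with its removable singularities removed and
with value `0` at its poles) that agrees with `f` on `U`. For `U` with an interior point there is
at most one such function. If there is none, the value is `f` itself. -/
def meromorphicContinuation (f : ℂ → ℂ) (U : Set ℂ) : ℂ → ℂ :=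
  if h : ∃ F : ℂ → ℂ, MeromorphicNFOn F Set.univ ∧ Set.EqOn F f U then h.choose else f

/-- Faddeev's noncompact quantum dilogarithm `Φ_b`, as a meromorphic function on `ℂ`. -/
def faddeev (ε : ℝ) (b : ℂ) : ℂ → ℂ :=
  meromorphicContinuation (faddeevIntegral ε b) (strip b)

/-- The complex number `√N`. -/
def sqrtN (N : ℕ) : ℂ := ((Real.sqrt N : ℝ) : ℂ)

/-- The normalization `φ_N(ζ) = Φ_{√N} (i ζ / √N - c_{√N} + i / √N)`. -/
def phiN (ε : ℝ) (N : ℕ) (ζ : ℂ) : ℂ :=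
  faddeev ε (sqrtN N) (I * (ζ / sqrtN N) - cConst (sqrtN N) + I / sqrtN N)

/-- The cyclic quantum dilogarithm
`Λ(ζ⁰, ζ¹ | n) = ω ^ (-ζ⁰ ζ¹ / 2) ω ^ (-n ζ¹) φ_N(ζ⁰ + n)`. -/
def cyclicLambda (ε : ℝ) (N : ℕ) (ζ₀ ζ₁ : ℂ) (n : ℤ) : ℂ :=
  omegaPow N (-(ζ₀ * ζ₁) / 2) * omegaPow N (-(n * ζ₁)) * phiN ε N (ζ₀ + n)

/-- The dilogarithm `Li₂(z) = ∫₀ᶻ -log (1 - t) / t dt`, along the segment `t = s z`,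
`0 ≤ s ≤ 1`, with the principal branch of the logarithm. -/
def Li2 (z : ℂ) : ℂ := ∫ s in (0 : ℝ)..1, -log (1 - s * z) / (s * z) * z

/-- The lifted dilogarithm
`L(ζ⁰, ζ¹) = Li₂(e^{2πiζ⁰}) + ((2πi)² / 2) ζ⁰ ζ¹ + 2πi ζ⁰ log (1 - e^{2πiζ⁰})`. -/
def liftedDilog (ζ₀ ζ₁ : ℂ) : ℂ :=
  Li2 (exp (2 * Real.pi * I * ζ₀)) + (2 * Real.pi * I) ^ 2 / 2 * ζ₀ * ζ₁ +
    2 * Real.pi * I * ζ₀ * log (1 - exp (2 * Real.pi * I * ζ₀))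

/-- `D(ζ) = exp ((1 / N) ∑_{k=1}^{N-1} k log (1 - ω ^ (ζ + k)))`. -/
def bigD (N : ℕ) (ζ : ℂ) : ℂ :=
  exp (1 / (N : ℂ) * ∑ k ∈ Finset.Icc 1 (N - 1), (k : ℂ) * log (1 - omegaPow N (ζ + k)))

/-- The circulant operator `Z` on `ℂ ^ N` with `Z v̂_n = ∑_{n'} Λ(ζ⁰, ζ¹ | n' - n) v̂_{n'}`, for a
basis `v̂_0, …, v̂_{N-1}`. -/
def circulantOp (ε : ℝ) (N : ℕ) (ζ₀ ζ₁ : ℂ) (v : Module.Basis (Fin N) ℂ (Fin N → ℂ)) :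
    (Fin N → ℂ) →ₗ[ℂ] (Fin N → ℂ) :=
  v.constr ℂ fun n => ∑ n' : Fin N, cyclicLambda ε N ζ₀ ζ₁ ((n' : ℤ) - (n : ℤ)) • v n'

end QuantumDilog

end

/-! Let E(x) = exp(-Li₂(e^{2πix})/(2πi) - x log(1 - e^{2πix})) (`dilogExp`), the quantum dilogarithm
at b = 1. In Faddeev's integral at b = √N put s = w√N and expand sinh s / sinh(s/N) as a sum of N
exponentials: the exponent splits into N integrals at b = 1, so φ_N(ζ) = ∏_{k<N} E((ζ-k)/N) away
from e^{2πiζ} = 1 (`phiN_eq_dilogProd`). That the integral at b = 1 is log E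
(`faddeevLog_eq_dilogLog`) follows by differentiating in x, which leaves a beta integral, and by
comparing along vertical lines, where both sides vanish as Im x → +∞.

The product gives φ_N(ζ+1) = φ_N(ζ)/(1 - ω^{ζ+1}), hence φ_N(ζ⁰+i-j) = φ_N(ζ⁰+N-1-j) ∏_{l<N-1-i} (1
- ω^{ζ⁰+i-j+1+l}). In the determinant of Λ(i-j) the column factors come out, and the powers of
ω^{ζ¹} cancel between rows and columns. Row i of what remains is a polynomial of degree N-1-i in
ω^{-j}, so the determinant is of Vandermonde type and ω^{ζ⁰} enters only through leading
coefficients. It equals ω^{N(N-1)ζ⁰/2} times its value at ω^{ζ⁰} = 1, where the matrix is triangular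
(`det_prod_one_sub_pow`); the diagonal contributes N^N/D(0)^N (`prod_one_sub_omegaPow_mul_bigD`).

The column factors multiply to ∏_{j<N} φ_N(ζ⁰+j) = E(ζ⁰) (`prod_dilogProd`), a consequence of
φ_N(ζ)^N = E(ζ) ∏_k (1 - ω^{ζ-k})^k (`dilogProd_pow`). Together with the N-th power of ω^{-ζ⁰ζ¹/2}
this is exp(-L(ζ⁰,ζ¹)/(2πi)). -/

namespace QuantumDilog

open Complex MeasureTheory Filter Topology Set

/-! ### The contour integral of e^{2xs} / sinh² s -/

/-- The kernel `e ^ (2 x s) / sinh² s`. -/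
noncomputable def sinhKernel (x s : ℂ) : ℂ := exp (2 * x * s) / sinh s ^ 2

lemma abs_sin_mul_cosh_le_norm_sinh (t y : ℝ) :
    |Real.sin y| * Real.cosh t ≤ ‖sinh ((t : ℂ) + I * y)‖ := by
  have h : (sinh ((t : ℂ) + I * y)).im = Real.cosh t * Real.sin y := by
    rw [mul_comm I, sinh_add, sinh_mul_I, cosh_mul_I, ← ofReal_sinh, ← ofReal_cosh,
      ← ofReal_sin, ← ofReal_cos]
    simp [sin_ofReal_re]
  calc |Real.sin y| * Real.cosh t = |(sinh ((t : ℂ) + I * y)).im| := by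
        rw [h, abs_mul, abs_of_pos (Real.cosh_pos t), mul_comm]
    _ ≤ _ := abs_im_le_norm _

lemma sinh_ne_zero_of_sin_ne_zero (t : ℝ) {y : ℝ} (hy : Real.sin y ≠ 0) :
    sinh ((t : ℂ) + I * y) ≠ 0 := by
  rw [← norm_pos_iff]
  exact (mul_pos (abs_pos.2 hy) (Real.cosh_pos t)).trans_le (abs_sin_mul_cosh_le_norm_sinh t y)

lemma half_exp_abs_le_cosh (t : ℝ) : Real.exp |t| / 2 ≤ Real.cosh t := by
  rw [← Real.cosh_abs, Real.cosh_eq]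
  have := Real.exp_pos (-|t|)
  linarith

lemma norm_sinhKernel_le {x : ℂ} {ρ : ℝ} (hx : |x.re| ≤ ρ) (t : ℝ) {y : ℝ}
    (hy : Real.sin y ≠ 0) :
    ‖sinhKernel x ((t : ℂ) + I * y)‖ ≤
      4 * Real.exp (-2 * y * x.im) / Real.sin y ^ 2 * Real.exp (-(2 * (1 - ρ)) * |t|) := by
  have h1 : ‖exp (2 * x * ((t : ℂ) + I * y))‖ ≤ Real.exp (-2 * y * x.im) * Real.exp (2 * ρ * |t|) := by
    rw [norm_exp, ← Real.exp_add]
    apply Real.exp_le_exp.2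
    have : (2 * x * ((t : ℂ) + I * y)).re = 2 * (x.re * t) - 2 * y * x.im := by
      simp; ring
    rw [this]
    have : x.re * t ≤ ρ * |t| := (le_abs_self _).trans (by rw [abs_mul]; gcongr)
    linarith
  have h2 : Real.sin y ^ 2 * (Real.exp |t| / 2) ^ 2 ≤ ‖sinh ((t : ℂ) + I * y) ^ 2‖ := by
    rw [norm_pow, ← sq_abs (Real.sin y), ← mul_pow]
    gcongr
    exact (mul_le_mul_of_nonneg_left (half_exp_abs_le_cosh t) (abs_nonneg _)).trans
      (abs_sin_mul_cosh_le_norm_sinh t y)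
  have h3 : 0 < Real.sin y ^ 2 * (Real.exp |t| / 2) ^ 2 := by positivity
  rw [sinhKernel, norm_div]
  refine (div_le_div₀ (by positivity) h1 h3 h2).trans (le_of_eq ?_)
  have : Real.exp (-(2 * (1 - ρ)) * |t|) = Real.exp (2 * ρ * |t|) / Real.exp |t| ^ 2 := by
    rw [← Real.exp_nat_mul, ← Real.exp_sub]
    congr 1
    push_cast
    ring
  rw [this]
  field_simp
  ring

lemma continuous_sinhKernel_line (x : ℂ) {y : ℝ} (hy : Real.sin y ≠ 0) :
    Continuous fun t : ℝ => sinhKernel x ((t : ℂ) + I * y) := by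
  unfold sinhKernel
  refine Continuous.div (by fun_prop) ?_ fun t => pow_ne_zero 2 (sinh_ne_zero_of_sin_ne_zero t hy)
  exact (continuous_sinh.comp (by fun_prop)).pow 2

lemma integrable_exp_neg_mul_abs {c : ℝ} (hc : 0 < c) :
    Integrable fun t : ℝ => Real.exp (-c * |t|) := by
  have h : IntegrableOn (fun t : ℝ => Real.exp (-c * |t|)) (Ioi 0) :=
    (exp_neg_integrableOn_Ioi 0 hc).congr_fun
      (fun t ht => by simp only [abs_of_pos (mem_Ioi.1 ht)]) measurableSet_Ioi
  rw [← integrableOn_univ, ← Iic_union_Ioi (a := (0 : ℝ))]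
  refine IntegrableOn.union ?_ h
  have h' := h
  rw [← integrableOn_Ici_iff_integrableOn_Ioi] at h'
  have := (Measure.measurePreserving_neg (volume : Measure ℝ)).integrableOn_comp_preimage
    (MeasurableEquiv.neg ℝ).measurableEmbedding (f := fun t : ℝ => Real.exp (-c * |t|)) (s := Ici 0)
  simpa [Function.comp_def] using this.2 h'

lemma integrable_sinhKernel {x : ℂ} (hx : |x.re| < 1) {y : ℝ} (hy : Real.sin y ≠ 0) :
    Integrable fun t : ℝ => sinhKernel x ((t : ℂ) + I * y) :=
  ((integrable_exp_neg_mul_abs (c := 2 * (1 - |x.re|)) (by linarith)).const_mul _).mono'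
    (continuous_sinhKernel_line x hy).aestronglyMeasurable
    (Eventually.of_forall fun t => norm_sinhKernel_le le_rfl t hy)

/-- The integral of the kernel over a horizontal line in `0 < Im s < π` does not depend on the
line. -/
lemma integral_sinhKernel_eq {x : ℂ} (hx : |x.re| < 1) {a b : ℝ} (ha : a ∈ Ioo 0 Real.pi)
    (hb : b ∈ Ioo 0 Real.pi) :
    ∫ t : ℝ, sinhKernel x ((t : ℂ) + I * a) = ∫ t : ℝ, sinhKernel x ((t : ℂ) + I * b) := by
  have hsin : ∀ y ∈ uIcc a b, Real.sin y ≠ 0 := fun y hy =>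
    have := (convex_Ioo 0 Real.pi).ordConnected.uIcc_subset ha hb hy
    (Real.sin_pos_of_pos_of_lt_pi this.1 this.2).ne'
  have hrect : ∀ T : ℝ,
      (∫ t in (-T)..T, sinhKernel x ((t : ℂ) + I * a)) -
        (∫ t in (-T)..T, sinhKernel x ((t : ℂ) + I * b)) +
      I • (∫ y in a..b, sinhKernel x (((T : ℝ) : ℂ) + I * y)) -
      I • (∫ y in a..b, sinhKernel x (((-T : ℝ) : ℂ) + I * y)) = 0 := by
    intro T
    have := integral_boundary_rect_eq_zero_of_differentiableOn (sinhKernel x)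
      ⟨-T, a⟩ ⟨T, b⟩ ?_
    · simpa only [mul_comm _ I] using this
    · intro s hs
      have hs2 : s.im ∈ uIcc a b := hs.2
      have hne : sinh s ≠ 0 := by
        have := sinh_ne_zero_of_sin_ne_zero s.re (hsin _ hs2)
        rwa [mul_comm I, re_add_im] at this
      refine DifferentiableAt.differentiableWithinAt ?_
      unfold sinhKernel
      exact DifferentiableAt.div (by fun_prop) (by fun_prop) (pow_ne_zero 2 hne)
  have hcont : ContinuousOn (fun y : ℝ => 4 * Real.exp (-2 * y * x.im) / Real.sin y ^ 2)
      (uIcc a b) :=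
    ContinuousOn.div (by fun_prop) (by fun_prop) fun y hy => pow_ne_zero 2 (hsin y hy)
  obtain ⟨C, hC⟩ := isCompact_uIcc.exists_bound_of_continuousOn hcont
  have hside : ∀ T : ℝ, ‖∫ y in a..b, sinhKernel x ((T : ℂ) + I * y)‖ ≤
      C * Real.exp (-(2 * (1 - |x.re|)) * |T|) * |b - a| := by
    intro T
    refine intervalIntegral.norm_integral_le_of_norm_le_const fun y hy => ?_
    have hy' := uIoc_subset_uIcc hy
    refine (norm_sinhKernel_le le_rfl T (hsin y hy')).trans ?_
    gcongr
    exact (le_abs_self _).trans (hC y hy')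
  have hdecay : Tendsto (fun T : ℝ => C * Real.exp (-(2 * (1 - |x.re|)) * |T|) * |b - a|)
      atTop (𝓝 0) := by
    have h1 : Tendsto (fun T : ℝ => -(2 * (1 - |x.re|)) * |T|) atTop atBot :=
      tendsto_abs_atTop_atTop.const_mul_atTop_of_neg (by linarith)
    simpa using ((Real.tendsto_exp_atBot.comp h1).const_mul C).mul_const |b - a|
  have hright : Tendsto (fun T : ℝ => ∫ y in a..b, sinhKernel x (((T : ℝ) : ℂ) + I * y))
      atTop (𝓝 0) := squeeze_zero_norm hside hdecay
  have hleft : Tendsto (fun T : ℝ => ∫ y in a..b, sinhKernel x (((-T : ℝ) : ℂ) + I * y))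
      atTop (𝓝 0) := squeeze_zero_norm (fun T => (hside (-T)).trans_eq (by rw [abs_neg])) hdecay
  have hA := intervalIntegral_tendsto_integral
    (integrable_sinhKernel hx (hsin a left_mem_uIcc)) tendsto_neg_atTop_atBot tendsto_id
  have hB := intervalIntegral_tendsto_integral
    (integrable_sinhKernel hx (hsin b right_mem_uIcc)) tendsto_neg_atTop_atBot tendsto_id
  have hlim := ((hA.sub hB).add (hright.const_smul I)).sub (hleft.const_smul I)
  have h0 := tendsto_nhds_unique hlim
    (tendsto_const_nhds.congr fun T => (hrect T).symm)
  simpa [sub_eq_zero] using h0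

/-- The substitution v = sigmoid(2t) does it: v/(1-v) = e^{2t} and dv = dt / (2 cosh² t), so the
integrand becomes 2 v^x (1-v)^{-x}. -/
lemma integral_exp_div_cosh_sq (x : ℂ) :
    ∫ t : ℝ, exp (2 * x * t) / cosh (t : ℂ) ^ 2 = 2 * betaIntegral (1 + x) (1 - x) := by
  have hder : ∀ t : ℝ, HasDerivAt (fun t : ℝ => Real.sigmoid (2 * t))
      (2 * (Real.sigmoid (2 * t) * (1 - Real.sigmoid (2 * t)))) t := fun t => by
    have := (Real.hasDerivAt_sigmoid (2 * t)).comp t ((hasDerivAt_id t).const_mul 2)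
    simpa [mul_comm, Function.comp_def] using this
  have hinj : InjOn (fun t : ℝ => Real.sigmoid (2 * t)) univ := fun s _ t _ h => by
    have := Real.sigmoid_injective h
    linarith
  have himg : (fun t : ℝ => Real.sigmoid (2 * t)) '' univ = Ioo 0 1 := by
    rw [← Real.range_sigmoid, image_univ]
    exact (mul_left_surjective₀ (two_ne_zero (α := ℝ))).range_comp Real.sigmoid
  have key := integral_image_eq_integral_abs_deriv_smul MeasurableSet.univ
    (fun t _ => (hder t).hasDerivWithinAt) hinj
    (fun v : ℝ => (v : ℂ) ^ (1 + x - 1) * (1 - (v : ℂ)) ^ (1 - x - 1))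
  rw [betaIntegral, intervalIntegral.integral_of_le zero_le_one, integral_Ioc_eq_integral_Ioo,
    ← himg, key, setIntegral_univ, ← integral_const_mul]
  congr 1
  ext t
  have hs0 := Real.sigmoid_pos (2 * t)
  have hs1 : 0 < 1 - Real.sigmoid (2 * t) := sub_pos.2 (Real.sigmoid_lt_one _)
  rw [abs_of_pos (by positivity)]
  have hpow : ((Real.sigmoid (2 * t) : ℝ) : ℂ) ^ (1 + x - 1) *
      (1 - ((Real.sigmoid (2 * t) : ℝ) : ℂ)) ^ (1 - x - 1) = exp (2 * x * t) := by
    have e1 : (1 - ((Real.sigmoid (2 * t) : ℝ) : ℂ)) = ((1 - Real.sigmoid (2 * t) : ℝ) : ℂ) := by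
      push_cast; rfl
    rw [e1, cpow_def_of_ne_zero (by exact_mod_cast hs0.ne'),
      cpow_def_of_ne_zero (by exact_mod_cast hs1.ne'), ← ofReal_log hs0.le, ← ofReal_log hs1.le,
      ← exp_add]
    congr 1
    have : Real.log (Real.sigmoid (2 * t)) = 2 * t + Real.log (1 - Real.sigmoid (2 * t)) := by
      rw [← Real.sigmoid_neg, ← Real.sigmoid_mul_rexp_neg,
        Real.log_mul hs0.ne' (Real.exp_pos _).ne', Real.log_exp]
      ring
    rw [this]
    push_cast
    ring
  have hcosh : 4 * (Real.sigmoid (2 * t) * (1 - Real.sigmoid (2 * t))) = 1 / Real.cosh t ^ 2 := by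
    rw [← Real.sigmoid_neg, Real.sigmoid_def, Real.sigmoid_def, Real.cosh_eq]
    have e2 : Real.exp (2 * t) = Real.exp t ^ 2 := by rw [← Real.exp_nat_mul]; norm_num
    rw [neg_neg, Real.exp_neg, Real.exp_neg, e2]
    have := Real.exp_pos t
    field_simp
    ring
  rw [hpow, real_smul, ← mul_assoc, div_eq_mul_one_div, mul_comm (exp _)]
  congr 1
  rw [← ofReal_cosh]
  have := congrArg (fun r : ℝ => (r : ℂ)) hcosh
  push_cast at this ⊢
  rw [← this]
  ring

lemma one_sub_exp_ne_zero {x : ℂ} (hx : |x.re| < 1) (hx0 : x ≠ 0) :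
    1 - exp (2 * Real.pi * I * x) ≠ 0 := by
  intro h
  obtain ⟨n, hn⟩ := exp_eq_one_iff.1 (sub_eq_zero.1 h).symm
  have : x = n := by
    have h2 : (2 * Real.pi * I : ℂ) ≠ 0 := two_pi_I_ne_zero
    apply mul_left_cancel₀ h2
    rw [hn, mul_comm]
  subst this
  have h1 : |(n : ℝ)| < 1 := by simpa using hx
  have : n = 0 := by
    rw [← Int.abs_lt_one_iff]
    exact_mod_cast h1
  exact hx0 (by simp [this])

/-- On the line Im s = π/2 one has sinh s = i cosh t, and the resulting beta integral is
Γ(1+x)Γ(1-x) = πx / sin πx. -/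
lemma integral_sinhKernel {x : ℂ} (hx : |x.re| < 1) (hx0 : x ≠ 0) {y : ℝ}
    (hy : y ∈ Ioo 0 Real.pi) :
    ∫ t : ℝ, sinhKernel x ((t : ℂ) + I * y) =
      4 * Real.pi * I * x * exp (2 * Real.pi * I * x) / (1 - exp (2 * Real.pi * I * x)) := by
  have hpi := Real.pi_pos
  rw [integral_sinhKernel_eq hx hy ⟨half_pos hpi, half_lt_self hpi⟩]
  have h1 : ∀ t : ℝ, sinhKernel x ((t : ℂ) + I * (Real.pi / 2 : ℝ)) =
      -exp (Real.pi * I * x) * (exp (2 * x * t) / cosh (t : ℂ) ^ 2) := by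
    intro t
    have : sinh ((t : ℂ) + I * (Real.pi / 2 : ℝ)) = I * cosh t := by
      rw [mul_comm I, sinh_add, sinh_mul_I, cosh_mul_I]
      push_cast
      rw [Complex.cos_pi_div_two, Complex.sin_pi_div_two]
      ring
    rw [sinhKernel, this, mul_pow, I_sq]
    have e : 2 * x * ((t : ℂ) + I * (Real.pi / 2 : ℝ)) = Real.pi * I * x + 2 * x * t := by
      push_cast; ring
    rw [e, exp_add]
    have : cosh (t : ℂ) ≠ 0 := by rw [← ofReal_cosh]; exact_mod_cast (Real.cosh_pos t).ne'
    field_simp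
  have hre := abs_lt.1 hx
  rw [integral_congr_ae (Eventually.of_forall h1), integral_const_mul,
    integral_exp_div_cosh_sq x, betaIntegral_eq_Gamma_mul_div _ _ (by simp; linarith)
      (by simp; linarith), add_comm 1 x, Gamma_add_one x hx0, mul_assoc x,
    Gamma_mul_Gamma_one_sub]
  have hne := one_sub_exp_ne_zero hx hx0
  have e2 : exp (2 * Real.pi * I * x) = exp (Real.pi * I * x) ^ 2 := by
    rw [← exp_nat_mul]; congr 1; push_cast; ring
  have hsin : sin (Real.pi * x) =
      I * (1 - exp (2 * Real.pi * I * x)) / (2 * exp (Real.pi * I * x)) := by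
    have e3 : -(Real.pi * x) * I = -(Real.pi * I * x) := by ring
    have e4 : (Real.pi * x) * I = (Real.pi * I * x) := by ring
    rw [Complex.sin, e3, e4, exp_neg, e2]
    have := exp_ne_zero (Real.pi * I * x)
    field_simp
  have hG : Gamma (x + 1 + (1 - x)) = 1 := by
    rw [show x + 1 + (1 - x) = 2 by ring]; simp
  rw [hG, hsin, e2]
  rw [e2] at hne
  have := exp_ne_zero (Real.pi * I * x)
  field_simp
  rw [I_sq]
  ring

/-! ### Faddeev's integral at b = 1: derivative and limit -/

/-- The exponent `∫ e ^ (2 x s) / (4 s sinh² s) ds` of Faddeev's integral at `b = 1`, along the line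
`Im s = y`. -/
noncomputable def faddeevLog (y : ℝ) (x : ℂ) : ℂ :=
  ∫ t : ℝ, sinhKernel x ((t : ℂ) + I * y) / (4 * ((t : ℂ) + I * y))

lemma add_I_mul_ne_zero (t : ℝ) {y : ℝ} (hy : 0 < y) : (t : ℂ) + I * y ≠ 0 := fun h => by
  have := congrArg im h
  simp at this
  exact hy.ne' this

lemma norm_sinhKernel_div_le (x : ℂ) (t : ℝ) {y : ℝ} (hy : 0 < y) :
    ‖sinhKernel x ((t : ℂ) + I * y) / (4 * ((t : ℂ) + I * y))‖ ≤
      ‖sinhKernel x ((t : ℂ) + I * y)‖ / (4 * y) := by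
  have h : y ≤ ‖(t : ℂ) + I * y‖ := by
    have := abs_im_le_norm ((t : ℂ) + I * y)
    simp only [add_im, ofReal_im, mul_im, I_re, I_im, ofReal_re, zero_mul, one_mul, zero_add] at this
    exact (le_abs_self y).trans this
  rw [norm_div, norm_mul]
  simp only [Complex.norm_ofNat]
  gcongr

lemma continuous_sinhKernel_div (x : ℂ) {y : ℝ} (hy : y ∈ Ioo 0 Real.pi) :
    Continuous fun t : ℝ => sinhKernel x ((t : ℂ) + I * y) / (4 * ((t : ℂ) + I * y)) :=
  (continuous_sinhKernel_line x (Real.sin_pos_of_pos_of_lt_pi hy.1 hy.2).ne').div (by fun_prop)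
    fun t => mul_ne_zero (by norm_num) (add_I_mul_ne_zero t hy.1)

lemma integrable_sinhKernel_div {x : ℂ} (hx : |x.re| < 1) {y : ℝ} (hy : y ∈ Ioo 0 Real.pi) :
    Integrable fun t : ℝ => sinhKernel x ((t : ℂ) + I * y) / (4 * ((t : ℂ) + I * y)) :=
  ((integrable_sinhKernel hx
    (Real.sin_pos_of_pos_of_lt_pi hy.1 hy.2).ne').norm.div_const (4 * y)).mono'
    (continuous_sinhKernel_div x hy).aestronglyMeasurable
    (Eventually.of_forall fun t => norm_sinhKernel_div_le x t hy.1)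

/-- Differentiating e^{2xs} brings down 2s, which cancels the factor 1/s and leaves the kernel
evaluated above. -/
lemma hasDerivAt_faddeevLog_integral {x : ℂ} (hx : |x.re| < 1) {y : ℝ} (hy : y ∈ Ioo 0 Real.pi) :
    HasDerivAt (faddeevLog y) (∫ t : ℝ, sinhKernel x ((t : ℂ) + I * y) / 2) x := by
  have hsin := (Real.sin_pos_of_pos_of_lt_pi hy.1 hy.2).ne'
  -- Half the distance to the boundary |Re x| = 1, so that one exponentially decaying bound serves
  -- the whole ball.
  set r : ℝ := (1 - |x.re|) / 2 with hr
  have hr0 : 0 < r := by rw [hr]; linarith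
  have hbd : ∀ x' ∈ Metric.ball x r, |x'.re| ≤ |x.re| + r ∧ |x'.im| ≤ |x.im| + r := by
    intro x' hx'
    have h := (mem_ball_iff_norm.1 hx').le
    have h1 := (abs_re_le_norm (x' - x)).trans h
    have h2 := (abs_im_le_norm (x' - x)).trans h
    rw [sub_re] at h1
    rw [sub_im] at h2
    exact ⟨by linarith [abs_sub_abs_le_abs_sub x'.re x.re],
      by linarith [abs_sub_abs_le_abs_sub x'.im x.im]⟩
  refine (hasDerivAt_integral_of_dominated_loc_of_deriv_le (μ := volume)
    (F := fun x (t : ℝ) => sinhKernel x ((t : ℂ) + I * y) / (4 * ((t : ℂ) + I * y)))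
    (F' := fun x (t : ℝ) => sinhKernel x ((t : ℂ) + I * y) / 2)
    (bound := fun t => (4 * Real.exp (2 * y * (|x.im| + r)) / Real.sin y ^ 2) *
      Real.exp (-(2 * (1 - (|x.re| + r))) * |t|))
    (Metric.ball_mem_nhds x hr0)
    (Eventually.of_forall fun x' => (continuous_sinhKernel_div x' hy).aestronglyMeasurable)
    (integrable_sinhKernel_div hx hy)
    ((continuous_sinhKernel_line x hsin).div_const 2).aestronglyMeasurable ?_ ?_ ?_).2
  · refine Eventually.of_forall fun t x' hx' => ?_
    rw [norm_div]
    refine (div_le_self (norm_nonneg _) (by simp)).trans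
      ((norm_sinhKernel_le (hbd x' hx').1 t hsin).trans ?_)
    have hle : -2 * y * x'.im ≤ 2 * y * (|x.im| + r) := by
      nlinarith [hy.1, neg_abs_le x'.im, (hbd x' hx').2]
    have := Real.exp_le_exp.2 hle
    gcongr
  · exact (integrable_exp_neg_mul_abs (by rw [hr]; linarith)).const_mul _
  · refine Eventually.of_forall fun t x' _ => ?_
    have hs := add_I_mul_ne_zero t hy.1
    unfold sinhKernel
    have h1 : HasDerivAt (fun x' : ℂ => exp (2 * x' * ((t : ℂ) + I * y)))
        (exp (2 * x' * ((t : ℂ) + I * y)) * (2 * ((t : ℂ) + I * y))) x' := by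
      have := (((hasDerivAt_id x').const_mul 2).mul_const ((t : ℂ) + I * y)).cexp
      simpa using this
    refine ((h1.div_const (sinh ((t : ℂ) + I * y) ^ 2)).div_const
      (4 * ((t : ℂ) + I * y))).congr_deriv ?_
    field_simp
    ring

lemma hasDerivAt_faddeevLog {x : ℂ} (hx : |x.re| < 1) (hx0 : x ≠ 0) {y : ℝ}
    (hy : y ∈ Ioo 0 Real.pi) :
    HasDerivAt (faddeevLog y)
      (2 * Real.pi * I * x * exp (2 * Real.pi * I * x) / (1 - exp (2 * Real.pi * I * x))) x := by
  convert hasDerivAt_faddeevLog_integral hx hy using 1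
  rw [integral_div, integral_sinhKernel hx hx0 hy]
  ring

/-- The contour lies above the real axis, so the kernel bound carries the factor e^{-2y Im x} =
e^{2yu}. -/
lemma tendsto_faddeevLog {θ : ℝ} (hθ : |θ| < 1) {y : ℝ} (hy : y ∈ Ioo 0 Real.pi) :
    Tendsto (fun u : ℝ => faddeevLog y (θ - I * u)) atBot (𝓝 0) := by
  have hsin := (Real.sin_pos_of_pos_of_lt_pi hy.1 hy.2).ne'
  have hre : ∀ u : ℝ, ((θ : ℂ) - I * u).re = θ := fun u => by simp
  have him : ∀ u : ℝ, ((θ : ℂ) - I * u).im = -u := fun u => by simp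
  have hint : Integrable fun t : ℝ => Real.exp (-(2 * (1 - |θ|)) * |t|) :=
    integrable_exp_neg_mul_abs (by linarith)
  have hbd : ∀ u : ℝ, ‖faddeevLog y (θ - I * u)‖ ≤
      4 * Real.exp (-2 * y * -u) / Real.sin y ^ 2 / (4 * y) *
        ∫ t : ℝ, Real.exp (-(2 * (1 - |θ|)) * |t|) := by
    intro u
    rw [← integral_const_mul]
    refine norm_integral_le_of_norm_le (hint.const_mul _) (Eventually.of_forall fun t => ?_)
    refine (norm_sinhKernel_div_le _ t hy.1).trans ?_
    rw [div_mul_eq_mul_div]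
    have := hy.1
    gcongr
    have := norm_sinhKernel_le (x := (θ : ℂ) - I * u) (ρ := |θ|) (by rw [hre]) t hsin
    rwa [him] at this
  refine squeeze_zero_norm hbd ?_
  have h1 : Tendsto (fun u : ℝ => -2 * y * -u) atBot atBot := by
    have : (fun u : ℝ => -2 * y * -u) = fun u => (2 * y) * u := by ext; ring
    rw [this]
    exact tendsto_id.const_mul_atBot (by linarith [hy.1])
  have h2 := (((((Real.tendsto_exp_atBot.comp h1).const_mul 4).div_const
    (Real.sin y ^ 2)).div_const (4 * y)).mul_const (∫ t : ℝ, Real.exp (-(2 * (1 - |θ|)) * |t|)))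
  simpa using h2

/-! ### Factorization of Faddeev's integral at b = √N -/

lemma sinh_mul_sum_exp (N : ℕ) (u : ℂ) :
    sinh u * ∑ k ∈ Finset.range N, exp (((N : ℂ) - 1 - 2 * k) * u) = sinh (N * u) := by
  have hterm : ∀ k : ℕ, sinh u * exp (((N : ℂ) - 1 - 2 * k) * u) =
      exp (((N : ℂ) - 2 * k) * u) / 2 - exp (((N : ℂ) - 2 * (k + 1 : ℕ)) * u) / 2 := by
    intro k
    rw [Complex.sinh, div_mul_eq_mul_div, sub_mul, ← exp_add, ← exp_add, sub_div]
    congr 3 <;> push_cast <;> ring_nf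
  rw [Finset.mul_sum, Finset.sum_congr rfl fun k _ => hterm k, Finset.sum_range_sub',
    Complex.sinh]
  push_cast
  ring_nf

lemma exp_div_sinh_mul_sinh (N : ℕ) (hN : N ≠ 0) (ζ s : ℂ) (h1 : sinh s ≠ 0)
    (h2 : sinh (s / N) ≠ 0) :
    exp ((2 * ζ - N + 1) * (s / N)) / (4 * sinh s * sinh (s / N)) / s =
      ∑ k ∈ Finset.range N, sinhKernel ((ζ - k) / N) s / (4 * s) := by
  have hN' : (N : ℂ) ≠ 0 := Nat.cast_ne_zero.2 hN
  have key := sinh_mul_sum_exp N (s / N)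
  rw [mul_div_cancel₀ s hN'] at key
  have hsum : ∑ k ∈ Finset.range N, sinhKernel ((ζ - k) / N) s / (4 * s) =
      exp ((2 * ζ - N + 1) * (s / N)) *
        (∑ k ∈ Finset.range N, exp (((N : ℂ) - 1 - 2 * k) * (s / N))) / sinh s ^ 2 / (4 * s) := by
    rw [Finset.mul_sum, Finset.sum_div, Finset.sum_div]
    refine Finset.sum_congr rfl fun k _ => ?_
    rw [sinhKernel, ← exp_add]
    congr 4
    field_simp
    ring
  rw [hsum, eq_div_of_mul_eq h2 ((mul_comm _ _).trans key)]
  field_simp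

lemma strip_argument (N : ℕ) (hN : N ≠ 0) (ζ : ℂ) :
    I * (ζ / sqrtN N) - cConst (sqrtN N) + I / sqrtN N =
      I / sqrtN N * (ζ - ((N : ℂ) - 1) / 2) := by
  have hs : sqrtN N ^ 2 = N := by
    rw [sqrtN, ← ofReal_pow, Real.sq_sqrt (Nat.cast_nonneg N), ofReal_natCast]
  have hs0 : sqrtN N ≠ 0 := fun h => hN (by
    rw [h] at hs
    exact_mod_cast (by simpa using hs.symm : (N : ℂ) = 0))
  rw [cConst, ← hs]
  field_simp
  ring

/-- Faddeev's integral at `b = √N` is a product of `N` integrals with `b = 1`. -/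
lemma faddeevIntegral_eq_prod (N : ℕ) (hN : N ≠ 0) {ε : ℝ} (hε : 0 < ε)
    (hε' : ε < Real.pi / Real.sqrt N) {ζ : ℂ} (h1 : -1 < ζ.re) (h2 : ζ.re < N) :
    faddeevIntegral ε (sqrtN N) (I / sqrtN N * (ζ - ((N : ℂ) - 1) / 2)) =
      ∏ k ∈ Finset.range N, exp (faddeevLog (ε * Real.sqrt N) ((ζ - k) / N)) := by
  have hNpos : (0 : ℝ) < N := by exact_mod_cast Nat.pos_of_ne_zero hN
  have hr : 0 < Real.sqrt N := Real.sqrt_pos.2 hNpos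
  have hy : ε * Real.sqrt N ∈ Ioo 0 Real.pi := ⟨by positivity, (lt_div_iff₀ hr).1 hε'⟩
  have hy' : ε * Real.sqrt N / N ∈ Ioo 0 Real.pi :=
    ⟨div_pos hy.1 hNpos, (div_le_self hy.1.le (by exact_mod_cast Nat.one_le_iff_ne_zero.2 hN)).trans_lt hy.2⟩
  have hre : ∀ k ∈ Finset.range N, |((ζ - k) / N : ℂ).re| < 1 := by
    intro k hk
    have hk' : (k : ℝ) + 1 ≤ N := by exact_mod_cast Finset.mem_range.1 hk
    have hk0 : (0 : ℝ) ≤ k := Nat.cast_nonneg k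
    rw [div_natCast_re, sub_re, natCast_re, abs_lt, lt_div_iff₀ hNpos, div_lt_iff₀ hNpos]
    constructor <;> linarith
  rw [faddeevIntegral, ← exp_sum]
  congr 1
  unfold faddeevLog
  rw [← integral_finsetSum _ fun k hk => integrable_sinhKernel_div (hre k hk) hy]
  set g : ℝ → ℂ := fun t => ∑ k ∈ Finset.range N,
    sinhKernel ((ζ - k) / N) ((t : ℂ) + I * (ε * Real.sqrt N : ℝ)) /
      (4 * ((t : ℂ) + I * (ε * Real.sqrt N : ℝ))) with hg
  -- Rescaling s = w√N turns wb into s and w/b into s/N; the contour height becomes ε√N, which lies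
  -- in (0, π).
  have hcomp := Measure.integral_comp_mul_left g (Real.sqrt N)
  rw [abs_of_pos (inv_pos.2 hr)] at hcomp
  have hg' : ∫ t, g t = Real.sqrt N • ∫ t, g (Real.sqrt N * t) := by
    rw [hcomp, smul_smul, mul_inv_cancel₀ hr.ne', one_smul]
  rw [hg', ← integral_smul]
  congr 1
  ext t
  have hrC : (Real.sqrt N : ℂ) ≠ 0 := by exact_mod_cast hr.ne'
  have hsq : (Real.sqrt N : ℂ) ^ 2 = N := by exact_mod_cast Real.sq_sqrt hNpos.le
  set s : ℂ := ((Real.sqrt N * t : ℝ) : ℂ) + I * (ε * Real.sqrt N : ℝ) with hs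
  have hs1 : ((t : ℂ) + I * ε) * sqrtN N = s := by
    rw [hs, sqrtN]; push_cast; ring
  have hs2 : ((t : ℂ) + I * ε) / sqrtN N = s / N := by
    rw [← hs1, ← hsq, sqrtN]; field_simp
  have hsinh1 : sinh s ≠ 0 :=
    sinh_ne_zero_of_sin_ne_zero _ (Real.sin_pos_of_pos_of_lt_pi hy.1 hy.2).ne'
  have hsinh2 : sinh (s / N) ≠ 0 := by
    have e : s / N = ((Real.sqrt N * t / N : ℝ) : ℂ) + I * (ε * Real.sqrt N / N : ℝ) := by
      rw [hs]; push_cast; ring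
    rw [e]
    exact sinh_ne_zero_of_sin_ne_zero _ (Real.sin_pos_of_pos_of_lt_pi hy'.1 hy'.2).ne'
  have hgt : g (Real.sqrt N * t) =
      exp ((2 * ζ - N + 1) * (s / N)) / (4 * sinh s * sinh (s / N)) / s := by
    rw [exp_div_sinh_mul_sinh N hN ζ s hsinh1 hsinh2]
  have hexp : -2 * I * (I / sqrtN N * (ζ - ((N : ℂ) - 1) / 2)) * ((t : ℂ) + I * ε) =
      (2 * ζ - N + 1) * (s / N) := by
    rw [← hs2]
    linear_combination (-2 * (ζ - ((N : ℂ) - 1) / 2) * (((t : ℂ) + I * ε) / sqrtN N)) * I_sq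
  have hs0 : (t : ℂ) + I * ε ≠ 0 := add_I_mul_ne_zero t hε
  rw [hgt, hexp, hs1, hs2, real_smul, ← hs1, sqrtN]
  field_simp

/-! ### The dilogarithm along rays from the origin -/

lemma one_sub_mem_slitPlane_or {u : ℂ} (hu : ‖u‖ = 1) {r : ℝ} (hr : 0 < r) (h : (r : ℂ) * u ≠ 1) :
    1 - (r : ℂ) * u ∈ slitPlane ∨ (u = 1 ∧ 1 < r) := by
  by_contra! hcon
  obtain ⟨h1, h2⟩ := hcon
  rw [mem_slitPlane_iff, not_or] at h1
  obtain ⟨hre, him⟩ := h1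
  have him' : u.im = 0 := by
    by_contra hne
    exact him (by simpa using ⟨hr.ne', hne⟩)
  have hure : u = (u.re : ℂ) := Complex.ext rfl (by simp [him'])
  have hre' : 1 ≤ r * u.re := by
    have : 1 - r * u.re ≤ 0 := by simpa [him'] using hre
    linarith
  have hupos : 0 < u.re := by
    by_contra! hneg
    nlinarith
  have hu1 : u.re = 1 := by
    rw [hure, norm_real, Real.norm_eq_abs, abs_of_pos hupos] at hu
    exact hu
  have hu' : u = 1 := by rw [hure, hu1, ofReal_one]
  have hr1 : r ≤ 1 := h2 hu'
  rw [hu1, mul_one] at hre'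
  exact h (by rw [hu', le_antisymm hr1 hre']; simp)

/-- Along a ray from the origin, `log (1 - ρ u)` is differentiable even on the branch cut. -/
lemma hasDerivAt_log_one_sub_ray {u : ℂ} (hu : ‖u‖ = 1) {r : ℝ} (hr : 0 < r)
    (h : (r : ℂ) * u ≠ 1) :
    HasDerivAt (fun ρ : ℝ => log (1 - (ρ : ℂ) * u)) (-u / (1 - (r : ℂ) * u)) r := by
  have hlin : HasDerivAt (fun ρ : ℝ => 1 - (ρ : ℂ) * u) (-u) r := by
    simpa using ((hasDerivAt_id r).ofReal_comp.mul_const u).const_sub 1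
  rcases one_sub_mem_slitPlane_or hu hr h with hs | ⟨rfl, hr1⟩
  · exact hlin.clog_real hs
  -- On the cut the principal argument is constantly π, so the logarithm is log(ρ - 1) + πi there.
  · have h1 : HasDerivAt (fun ρ : ℝ => ((Real.log (ρ - 1) : ℝ) : ℂ) + Real.pi * I)
        (((1 / (r - 1) : ℝ) : ℂ)) r :=
      (((hasDerivAt_id r).sub_const 1).log (sub_pos.2 hr1).ne').ofReal_comp.add_const _
    have hne : (r : ℂ) - 1 ≠ 0 := by exact_mod_cast (sub_pos.2 hr1).ne'
    have hne' : 1 - (r : ℂ) ≠ 0 := by rw [← neg_sub]; exact neg_ne_zero.2 hne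
    refine (h1.congr_of_eventuallyEq ?_).congr_deriv ?_
    · filter_upwards [lt_mem_nhds hr1] with ρ hρ
      have e : 1 - (ρ : ℂ) * 1 = -(((ρ - 1 : ℝ)) : ℂ) := by push_cast; ring
      have hρ' := sub_pos.2 hρ
      rw [e, log, norm_neg, norm_real, Real.norm_of_nonneg hρ'.le, ← ofReal_neg,
        arg_ofReal_of_neg (neg_neg_of_pos hρ')]
    · push_cast
      rw [mul_one]
      field_simp
      ring

/-- The integrand of the dilogarithm on the ray through `u`. -/
noncomputable def Li2Integrand (u : ℂ) (ρ : ℝ) : ℂ := -log (1 - (ρ : ℂ) * u) / ρ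

lemma Li2_real_mul {u : ℂ} (hu : u ≠ 0) {r : ℝ} (hr : 0 < r) :
    Li2 ((r : ℂ) * u) = ∫ ρ in (0 : ℝ)..r, Li2Integrand u ρ := by
  have h := intervalIntegral.smul_integral_comp_mul_right (a := 0) (b := 1) (Li2Integrand u) r
  rw [zero_mul, one_mul] at h
  rw [← h, ← intervalIntegral.integral_smul, Li2]
  congr 1
  ext s
  have hr' : (r : ℂ) ≠ 0 := by exact_mod_cast hr.ne'
  rw [Li2Integrand, real_smul]
  push_cast
  rw [← mul_assoc (s : ℂ) r u]
  rcases eq_or_ne (s : ℂ) 0 with hs | hs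
  · simp [hs]
  · field_simp

lemma abs_log_norm_one_sub_le {u : ℂ} (hu : ‖u‖ = 1) {ρ R : ℝ} (hρ : 0 < ρ) (hρR : ρ ≤ R)
    (hρ1 : ρ ≠ 1) :
    |Real.log ‖1 - (ρ : ℂ) * u‖| ≤ |Real.log (1 - ρ)| + Real.log (1 + R) := by
  have hn : ‖(ρ : ℂ) * u‖ = ρ := by rw [norm_mul, hu, mul_one, norm_real, Real.norm_of_nonneg hρ.le]
  have hlow : |1 - ρ| ≤ ‖1 - (ρ : ℂ) * u‖ := by
    have := abs_norm_sub_norm_le 1 ((ρ : ℂ) * u)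
    rwa [hn, norm_one] at this
  have hup : ‖1 - (ρ : ℂ) * u‖ ≤ 1 + R := by
    have := norm_sub_le 1 ((ρ : ℂ) * u)
    rw [hn, norm_one] at this
    linarith
  have hpos : 0 < |1 - ρ| := abs_pos.2 (sub_ne_zero.2 hρ1.symm)
  have h1 := Real.log_le_log hpos hlow
  rw [Real.log_abs] at h1
  have h2 := Real.log_le_log (hpos.trans_le hlow) hup
  have h3 : 0 ≤ Real.log (1 + R) := Real.log_nonneg (by linarith)
  rw [abs_le]
  constructor
  · linarith [neg_abs_le (Real.log (1 - ρ))]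
  · linarith [abs_nonneg (Real.log (1 - ρ))]

lemma norm_log_le_abs_log_norm_add_pi (z : ℂ) : ‖log z‖ ≤ |Real.log ‖z‖| + Real.pi := by
  refine (norm_le_abs_re_add_abs_im _).trans ?_
  rw [log_re, log_im]
  gcongr
  exact abs_arg_le_pi z

lemma norm_log_one_sub_le {z : ℂ} (hz : ‖z‖ ≤ 1 / 2) : ‖log (1 - z)‖ ≤ 3 / 2 * ‖z‖ := by
  have := norm_log_one_add_half_le_self (z := -z) (by rwa [norm_neg])
  rwa [norm_neg, ← sub_eq_add_neg] at this

lemma intervalIntegrable_Li2Integrand {u : ℂ} (hu : ‖u‖ = 1) {R : ℝ} (hR : 0 ≤ R) :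
    IntervalIntegrable (Li2Integrand u) volume 0 R := by
  have hlog : IntervalIntegrable (fun ρ : ℝ => |Real.log (1 - ρ)|) volume 0 R := by
    have h : IntervalIntegrable Real.log volume (1 - 0) (1 - R) :=
      intervalIntegral.intervalIntegrable_log'
    have := h.comp_sub_left 1
    simp only [sub_sub_cancel] at this
    exact this.abs
  -- The term 3/2 controls the integrand for ρ ≤ 1/2, where |log(1-z)| ≤ (3/2)|z|. For ρ ≥ 1/2 the
  -- division by ρ costs a factor 2, and the singularity at ρ = 1 is at worst logarithmic.
  have hbound : IntervalIntegrable
      (fun ρ : ℝ => 3 / 2 + 2 * (|Real.log (1 - ρ)| + Real.log (1 + R) + Real.pi)) volume 0 R :=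
    intervalIntegrable_const.add
      (((hlog.add intervalIntegrable_const).add intervalIntegrable_const).const_mul 2)
  refine hbound.mono_fun' ?_ ?_
  · refine Measurable.aestronglyMeasurable ?_
    unfold Li2Integrand
    exact ((measurable_log.comp (by fun_prop)).neg).div (by fun_prop)
  · rw [uIoc_of_le hR, EventuallyLE, ae_restrict_iff' measurableSet_Ioc]
    filter_upwards [compl_mem_ae_iff.2 (measure_singleton (1 : ℝ))] with ρ hρ1 hρ
    have hρ0 := hρ.1
    have hn : ‖(ρ : ℂ) * u‖ = ρ := by
      rw [norm_mul, hu, mul_one, norm_real, Real.norm_of_nonneg hρ0.le]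
    rw [Li2Integrand, norm_div, norm_neg, norm_real, Real.norm_of_nonneg hρ0.le]
    have hpos : 0 ≤ |Real.log (1 - ρ)| + Real.log (1 + R) + Real.pi := by
      have := Real.log_nonneg (show 1 ≤ 1 + R by linarith)
      have := Real.pi_pos
      positivity
    rw [div_le_iff₀ hρ0]
    rcases le_total ρ (1 / 2) with h | h
    · have := norm_log_one_sub_le (z := (ρ : ℂ) * u) (by rw [hn]; exact h)
      rw [hn] at this
      nlinarith
    · have h1 := norm_log_le_abs_log_norm_add_pi (1 - (ρ : ℂ) * u)
      have h2 := abs_log_norm_one_sub_le hu hρ0 hρ.2 hρ1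
      nlinarith

lemma hasDerivAt_Li2_ray {u : ℂ} (hu : ‖u‖ = 1) {r : ℝ} (hr : 0 < r) (h : (r : ℂ) * u ≠ 1) :
    HasDerivAt (fun r : ℝ => Li2 ((r : ℂ) * u)) (Li2Integrand u r) r := by
  have hu0 : u ≠ 0 := norm_ne_zero_iff.1 (by rw [hu]; exact one_ne_zero)
  have hmeas : Measurable (Li2Integrand u) := by
    unfold Li2Integrand
    exact ((measurable_log.comp (by fun_prop)).neg).div (by fun_prop)
  have := intervalIntegral.integral_hasDerivAt_right (intervalIntegrable_Li2Integrand hu hr.le)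
    (hmeas.stronglyMeasurable.stronglyMeasurableAtFilter)
    ((hasDerivAt_log_one_sub_ray hu hr h).continuousAt.neg.div
      (by fun_prop) (by exact_mod_cast hr.ne'))
  refine this.congr_of_eventuallyEq ?_
  filter_upwards [lt_mem_nhds hr] with ρ hρ using Li2_real_mul hu0 hρ

lemma continuousAt_Li2_ray {u : ℂ} (hu : ‖u‖ = 1) {r : ℝ} (hr : 0 < r) :
    ContinuousAt (fun r : ℝ => Li2 ((r : ℂ) * u)) r := by
  have hu0 : u ≠ 0 := norm_ne_zero_iff.1 (by rw [hu]; exact one_ne_zero)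
  have h := intervalIntegral.continuousOn_primitive_interval'
    (intervalIntegrable_Li2Integrand hu (R := r + 1) (by linarith)) left_mem_uIcc
  have h' : ContinuousAt (fun b => ∫ ρ in (0 : ℝ)..b, Li2Integrand u ρ) r := by
    refine h.continuousAt ?_
    rw [uIcc_of_le (by linarith)]
    exact Icc_mem_nhds hr (by linarith)
  refine h'.congr ?_
  filter_upwards [lt_mem_nhds hr] with ρ hρ using (Li2_real_mul hu0 hρ).symm

lemma tendsto_Li2_ray_zero {u : ℂ} (hu : ‖u‖ = 1) :
    Tendsto (fun r : ℝ => Li2 ((r : ℂ) * u)) (𝓝[>] 0) (𝓝 0) := by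
  have hu0 : u ≠ 0 := norm_ne_zero_iff.1 (by rw [hu]; exact one_ne_zero)
  have h := intervalIntegral.continuousOn_primitive_interval'
    (intervalIntegrable_Li2Integrand hu (R := 1) zero_le_one) left_mem_uIcc 0 left_mem_uIcc
  rw [ContinuousWithinAt, intervalIntegral.integral_same, uIcc_of_le zero_le_one] at h
  refine (h.mono_left (nhdsWithin_le_of_mem (Icc_mem_nhdsGT zero_lt_one))).congr' ?_
  filter_upwards [self_mem_nhdsWithin] with ρ hρ using (Li2_real_mul hu0 hρ).symm

/-! ### Closed form of the integral at b = 1 -/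

/-- The closed form `-Li₂(e^{2πix}) / (2πi) - x log (1 - e^{2πix})` of the logarithm of the
quantum dilogarithm at `b = 1`. -/
noncomputable def dilogLog (x : ℂ) : ℂ :=
  -(Li2 (exp (2 * Real.pi * I * x)) / (2 * Real.pi * I)) - x * log (1 - exp (2 * Real.pi * I * x))

lemma norm_exp_two_pi_I_mul (θ : ℝ) : ‖exp (2 * Real.pi * I * θ)‖ = 1 := by
  have : (2 * Real.pi * I * θ : ℂ) = ((2 * Real.pi * θ : ℝ) : ℂ) * I := by push_cast; ring
  rw [this, norm_exp_ofReal_mul_I]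

lemma exp_two_pi_I_mul_sub (θ y : ℝ) : exp (2 * Real.pi * I * ((θ : ℂ) - I * y)) =
    ((Real.exp (2 * Real.pi * y) : ℝ) : ℂ) * exp (2 * Real.pi * I * θ) := by
  rw [ofReal_exp, ← exp_add]
  congr 1
  push_cast
  linear_combination (-2 * Real.pi * y : ℂ) * I_sq

lemma dilogLog_line (θ y : ℝ) : dilogLog ((θ : ℂ) - I * y) =
    -(Li2 (((Real.exp (2 * Real.pi * y) : ℝ) : ℂ) * exp (2 * Real.pi * I * θ)) /
      (2 * Real.pi * I)) - ((θ : ℂ) - I * y) *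
      log (1 - ((Real.exp (2 * Real.pi * y) : ℝ) : ℂ) * exp (2 * Real.pi * I * θ)) := by
  rw [dilogLog, exp_two_pi_I_mul_sub]

lemma hasDerivAt_exp_two_pi_mul (y : ℝ) :
    HasDerivAt (fun y : ℝ => Real.exp (2 * Real.pi * y))
      (Real.exp (2 * Real.pi * y) * (2 * Real.pi)) y := by
  simpa using ((hasDerivAt_id y).const_mul (2 * Real.pi)).exp

lemma hasDerivAt_line (θ y : ℝ) : HasDerivAt (fun y : ℝ => (θ : ℂ) - I * y) (-I) y := by
  simpa using ((hasDerivAt_id y).ofReal_comp.const_mul I).const_sub (θ : ℂ)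

/-- The logarithm from differentiating Li₂ cancels the one from differentiating the prefactor x;
only x times the derivative of the logarithm survives. -/
lemma hasDerivAt_dilogLog_line (θ y : ℝ)
    (h : exp (2 * Real.pi * I * ((θ : ℂ) - I * y)) ≠ 1) :
    HasDerivAt (fun y : ℝ => dilogLog ((θ : ℂ) - I * y))
      (2 * Real.pi * I * ((θ : ℂ) - I * y) * exp (2 * Real.pi * I * ((θ : ℂ) - I * y)) /
        (1 - exp (2 * Real.pi * I * ((θ : ℂ) - I * y))) * -I) y := by
  have hu := norm_exp_two_pi_I_mul θ
  rw [exp_two_pi_I_mul_sub] at h ⊢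
  simp only [dilogLog_line]
  set u := exp (2 * Real.pi * I * θ)
  have hr := Real.exp_pos (2 * Real.pi * y)
  have hE := hasDerivAt_exp_two_pi_mul y
  have h1 := (hasDerivAt_Li2_ray hu hr h).scomp y hE
  have h2 := (hasDerivAt_log_one_sub_ray hu hr h).scomp y hE
  have h3 := hasDerivAt_line θ y
  simp only [Function.comp_def] at h1 h2
  refine ((h1.div_const (2 * Real.pi * I)).neg.sub (h3.mul h2)).congr_deriv ?_
  set r := Real.exp (2 * Real.pi * y)
  have hr' : (r : ℂ) ≠ 0 := by exact_mod_cast hr.ne'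
  have hz : 1 - (r : ℂ) * u ≠ 0 := sub_ne_zero.2 h.symm
  have hpi : (Real.pi : ℂ) ≠ 0 := by exact_mod_cast Real.pi_ne_zero
  rw [Li2Integrand, real_smul, real_smul]
  push_cast
  field_simp
  ring_nf
  simp only [I_sq, I_pow_three, I_pow_four]
  ring

lemma continuousAt_dilogLog_line_zero :
    ContinuousAt (fun y : ℝ => dilogLog (((0 : ℝ) : ℂ) - I * y)) 0 := by
  simp only [dilogLog_line]
  have hu := norm_exp_two_pi_I_mul 0
  have hE := (hasDerivAt_exp_two_pi_mul 0)
  refine ContinuousAt.sub ?_ ?_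
  · refine (ContinuousAt.div_const ?_ _).neg
    exact ContinuousAt.comp (g := fun r : ℝ => Li2 ((r : ℂ) * exp (2 * Real.pi * I * (0 : ℝ))))
      (continuousAt_Li2_ray hu (Real.exp_pos _)) hE.continuousAt
  -- 1 - e^{2πy} has a simple zero at 0, so y log(1 - e^{2πy}) is controlled by t log t → 0.
  · have hbig : (fun y : ℝ => y) =O[𝓝 0] fun y => 1 - Real.exp (2 * Real.pi * y) := by
      have := (HasDerivAtFilter.isTheta_sub hE (by simp [Real.pi_ne_zero])).isBigO_symm
      have h2 := (this.comp_tendsto (k := fun y : ℝ => (y, (0 : ℝ))) (l' := 𝓝 0) ?_).neg_right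
      · simpa [Function.comp_def] using h2
      · exact tendsto_id.prodMk tendsto_const_pure
    have h0 : Tendsto (fun y : ℝ => 1 - Real.exp (2 * Real.pi * y)) (𝓝 0) (𝓝 0) := by
      have := hE.continuousAt.tendsto.const_sub 1
      simpa using this
    have h1 : Tendsto (fun y : ℝ => y * Real.log (1 - Real.exp (2 * Real.pi * y))) (𝓝 0)
        (𝓝 0) := by
      refine (hbig.mul (Asymptotics.isBigO_refl _ _)).trans_tendsto ?_
      have := (Real.continuous_mul_log.tendsto 0).comp h0
      simpa [Function.comp_def] using this
    have h2 : Tendsto (fun y : ℝ => |y * Real.log (1 - Real.exp (2 * Real.pi * y))| +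
        |y| * Real.pi) (𝓝 0) (𝓝 0) := by
      simpa using h1.abs.add ((continuous_abs.tendsto (0 : ℝ)).mul_const Real.pi)
    have hval : (((0 : ℝ) : ℂ) - I * (0 : ℝ)) * log (1 - ((Real.exp (2 * Real.pi * 0) : ℝ) : ℂ) *
        exp (2 * Real.pi * I * (0 : ℝ))) = 0 := by simp
    rw [ContinuousAt, hval]
    refine squeeze_zero_norm (fun y => ?_) h2
    have e : ‖((0 : ℝ) : ℂ) - I * y‖ = |y| := by simp
    have e2 : 1 - ((Real.exp (2 * Real.pi * y) : ℝ) : ℂ) * exp (2 * Real.pi * I * (0 : ℝ)) =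
        ((1 - Real.exp (2 * Real.pi * y) : ℝ) : ℂ) := by simp
    rw [norm_mul, e, e2, abs_mul, ← mul_add]
    gcongr
    have := norm_log_le_abs_log_norm_add_pi ((1 - Real.exp (2 * Real.pi * y) : ℝ) : ℂ)
    rwa [norm_real, Real.norm_eq_abs, Real.log_abs] at this

lemma tendsto_dilogLog_line (θ : ℝ) :
    Tendsto (fun y : ℝ => dilogLog ((θ : ℂ) - I * y)) atBot (𝓝 0) := by
  simp only [dilogLog_line]
  have hu := norm_exp_two_pi_I_mul θ
  set u := exp (2 * Real.pi * I * θ)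
  have hlin : Tendsto (fun y : ℝ => 2 * Real.pi * y) atBot atBot :=
    tendsto_id.const_mul_atBot Real.two_pi_pos
  have hr : Tendsto (fun y : ℝ => Real.exp (2 * Real.pi * y)) atBot (𝓝[>] 0) :=
    Real.tendsto_exp_atBot_nhdsGT.comp hlin
  have h1 := (tendsto_Li2_ray_zero hu).comp hr
  have h2 : Tendsto (fun y : ℝ => ((θ : ℂ) - I * y) *
      log (1 - ((Real.exp (2 * Real.pi * y) : ℝ) : ℂ) * u)) atBot (𝓝 0) := by
    have hrlog : Tendsto (fun y : ℝ => 2 * Real.pi * y * Real.exp (2 * Real.pi * y)) atBot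
        (𝓝 0) := by
      have := ((Real.continuous_mul_log.tendsto 0).mono_left nhdsWithin_le_nhds).comp hr
      simpa [Function.comp_def, mul_comm] using this
    have hb : Tendsto (fun y : ℝ => |θ| * (3 / 2 * Real.exp (2 * Real.pi * y)) +
        3 / 2 * (|2 * Real.pi * y * Real.exp (2 * Real.pi * y)|)) atBot (𝓝 0) := by
      have a := ((hr.mono_right nhdsWithin_le_nhds).const_mul (3 / 2)).const_mul |θ|
      have b := hrlog.abs.const_mul (3 / 2)
      simpa using a.add b
    refine squeeze_zero_norm' ?_ hb
    have hsmall := (hr.mono_right nhdsWithin_le_nhds).eventually (Iic_mem_nhds (show (0 : ℝ) < 1 / 2 by norm_num))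
    filter_upwards [hsmall] with y hy
    have hpos := Real.exp_pos (2 * Real.pi * y)
    have hn : ‖((Real.exp (2 * Real.pi * y) : ℝ) : ℂ) * u‖ = Real.exp (2 * Real.pi * y) := by
      rw [norm_mul, hu, mul_one, norm_real, Real.norm_of_nonneg hpos.le]
    have hl := norm_log_one_sub_le (hn.le.trans hy)
    rw [hn] at hl
    have hx : ‖(θ : ℂ) - I * y‖ ≤ |θ| + |2 * Real.pi * y| := by
      refine (norm_sub_le _ _).trans ?_
      rw [norm_real, norm_mul, norm_I, one_mul, norm_real, Real.norm_eq_abs, Real.norm_eq_abs,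
        abs_mul, abs_of_pos Real.two_pi_pos]
      have := Real.pi_gt_three
      nlinarith [abs_nonneg y]
    rw [norm_mul]
    calc _ ≤ (|θ| + |2 * Real.pi * y|) * (3 / 2 * Real.exp (2 * Real.pi * y)) := by gcongr
      _ = _ := by rw [abs_mul _ (Real.exp _), abs_of_pos hpos]; ring
  simpa [Function.comp_def] using ((h1.div_const (2 * Real.pi * I)).neg.sub h2)

/-- The exceptional point is needed for the line Re x = 0, which passes through x = 0, where the
closed form of the derivative breaks down. -/
lemma eq_zero_of_hasDerivAt_zero_off_zero {D : ℝ → ℂ} (hc : Continuous D)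
    (hd : ∀ y ≠ 0, HasDerivAt D 0 y) (hl : Tendsto D atBot (𝓝 0)) (y : ℝ) : D y = 0 := by
  have hconst : ∀ a, D a = D y := fun a => by
    have := integral_eq_of_hasDerivAt_off_countable D (fun _ => 0) (a := a) (b := y)
      (countable_singleton (0 : ℝ)) hc.continuousOn (fun x hx => hd x hx.2) intervalIntegrable_const
    simpa [sub_eq_zero, eq_comm] using this
  exact tendsto_nhds_unique (tendsto_const_nhds.congr fun a => (hconst a).symm) hl

lemma line_ne_zero (θ : ℝ) {y : ℝ} (hy : y ≠ 0) : (θ : ℂ) - I * y ≠ 0 := fun h => by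
  have := congrArg im h
  simp at this
  exact hy this

/-- On a vertical line e^{2πix} moves along a ray, like the path defining Li₂, so the principal
branches never jump. Both sides then have the same derivative and the limit 0 as Im x → +∞. -/
lemma faddeevLog_eq_dilogLog {x : ℂ} (hx : |x.re| < 1) {y : ℝ} (hy : y ∈ Ioo 0 Real.pi) :
    faddeevLog y x = dilogLog x := by
  set θ := x.re
  have hline : x = (θ : ℂ) - I * ((-x.im : ℝ) : ℂ) := by
    apply Complex.ext <;> simp [θ]
  have hre : ∀ v : ℝ, |((θ : ℂ) - I * v).re| < 1 := fun v => by simpa using hx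
  have hderiv : ∀ v : ℝ, (θ : ℂ) - I * v ≠ 0 → HasDerivAt
      (fun v : ℝ => faddeevLog y ((θ : ℂ) - I * v) - dilogLog ((θ : ℂ) - I * v)) 0 v := by
    intro v hv
    have h1 := (hasDerivAt_faddeevLog (hre v) hv hy).comp v (hasDerivAt_line θ v)
    have h2 := hasDerivAt_dilogLog_line θ v
      (fun h => one_sub_exp_ne_zero (hre v) hv (by rw [h, sub_self]))
    exact (h1.sub h2).congr_deriv (sub_self _)
  have hcont : Continuous
      (fun v : ℝ => faddeevLog y ((θ : ℂ) - I * v) - dilogLog ((θ : ℂ) - I * v)) := by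
    rw [continuous_iff_continuousAt]
    intro v
    by_cases hv : (θ : ℂ) - I * v = 0
    · have hθ : θ = 0 := by simpa using congrArg re hv
      have hv0 : v = 0 := by
        by_contra hne
        exact line_ne_zero θ hne hv
      refine ContinuousAt.sub ?_ ?_
      · exact ContinuousAt.comp (g := faddeevLog y)
          (hasDerivAt_faddeevLog_integral (hre v) hy).continuousAt
          (hasDerivAt_line θ v).continuousAt
      · rw [hθ, hv0]
        exact continuousAt_dilogLog_line_zero
    · exact (hderiv v hv).continuousAt
  have hlim := (tendsto_faddeevLog hx hy).sub (tendsto_dilogLog_line θ)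
  rw [sub_zero] at hlim
  have := eq_zero_of_hasDerivAt_zero_off_zero hcont
    (fun v hv => hderiv v (line_ne_zero θ hv)) hlim (-x.im)
  rw [← hline] at this
  exact sub_eq_zero.1 this

/-! ### Uniqueness of the meromorphic continuation -/

lemma meromorphicContinuation_eq_of_analyticAt {f F₀ : ℂ → ℂ} {U : Set ℂ} (hU : IsOpen U)
    (hne : U.Nonempty) (hF₀ : MeromorphicOn F₀ univ) (hF₀U : AnalyticOnNhd ℂ F₀ U)
    (heq : EqOn F₀ f U) {z : ℂ} (hz : AnalyticAt ℂ F₀ z) :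
    meromorphicContinuation f U z = F₀ z := by
  have hex : ∃ F : ℂ → ℂ, MeromorphicNFOn F univ ∧ EqOn F f U := by
    refine ⟨toMeromorphicNFOn F₀ univ, meromorphicNFOn_toMeromorphicNFOn F₀ univ, fun u hu => ?_⟩
    rw [toMeromorphicNFOn_eq_toMeromorphicNFAt hF₀ (mem_univ u),
      toMeromorphicNFAt_eq_self.2 (hF₀U u hu).meromorphicNFAt]
    exact heq hu
  rw [meromorphicContinuation, dif_pos hex]
  obtain ⟨hF, hFU⟩ := hex.choose_spec
  set F := hex.choose
  -- Identity theorem: the difference has infinite order at a point of U, hence everywhere on the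
  -- connected plane. Normal form then fixes the value at z itself.
  have hmer : MeromorphicOn (F - F₀) univ := fun w hw => (hF hw).meromorphicAt.sub (hF₀ w hw)
  obtain ⟨u, hu⟩ := hne
  have htop : meromorphicOrderAt (F - F₀) u = ⊤ := by
    rw [meromorphicOrderAt_eq_top_iff]
    refine Filter.Eventually.filter_mono nhdsWithin_le_nhds ?_
    filter_upwards [hU.mem_nhds hu] with w hw
    simp [hFU hw, heq hw]
  have hztop : meromorphicOrderAt (F - F₀) z = ⊤ := by
    by_contra h
    exact hmer.meromorphicOrderAt_ne_top_of_isPreconnected isPreconnected_univ (mem_univ z)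
      (mem_univ u) h htop
  rw [meromorphicOrderAt_eq_top_iff] at hztop
  have h1 : F =ᶠ[𝓝[≠] z] F₀ := by
    filter_upwards [hztop] with w hw
    exact sub_eq_zero.1 hw
  exact (((hF (mem_univ z)).eventuallyEq_nhdsNE_iff_eventuallyEq_nhds hz.meromorphicNFAt).1
    h1).eq_of_nhds

/-! ### Continuation of E and the product formula for φ_N -/

/-- The quantum dilogarithm at `b = 1`. -/
noncomputable def dilogExp (x : ℂ) : ℂ := exp (dilogLog x)

lemma exp_two_pi_I_mul_add_int (x : ℂ) (n : ℤ) :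
    exp (2 * Real.pi * I * (x + n)) = exp (2 * Real.pi * I * x) := by
  rw [mul_add, exp_add, mul_comm _ (n : ℂ), exp_int_mul_two_pi_mul_I, mul_one]

/-- Since e^{2πix} has period 1, only the prefactor x of the logarithm changes. -/
lemma dilogExp_add_one {x : ℂ} (hx : 1 - exp (2 * Real.pi * I * x) ≠ 0) :
    dilogExp (x + 1) = dilogExp x / (1 - exp (2 * Real.pi * I * x)) := by
  have h := exp_two_pi_I_mul_add_int x 1
  rw [Int.cast_one] at h
  rw [dilogExp, dilogExp, dilogLog, dilogLog, h]
  conv_rhs => rw [← exp_log hx]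
  rw [← exp_sub]
  congr 1
  rw [exp_log hx]
  ring

lemma dilogExp_add_int {x : ℂ} (hx : 1 - exp (2 * Real.pi * I * x) ≠ 0) (n : ℤ) :
    dilogExp (x + n) = dilogExp x * (1 - exp (2 * Real.pi * I * x)) ^ (-n) := by
  induction n using Int.induction_on with
  | zero => simp
  | succ i ih =>
    have h := dilogExp_add_one (x := x + (i : ℤ)) (by rwa [exp_two_pi_I_mul_add_int])
    rw [exp_two_pi_I_mul_add_int, ih] at h
    rw [neg_add, zpow_add₀ hx, ← mul_assoc]
    push_cast at h ⊢
    rw [← add_assoc, h, zpow_neg_one, div_eq_mul_inv]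
  | pred i ih =>
    have h := dilogExp_add_one (x := x + (-i - 1 : ℤ)) (by rwa [exp_two_pi_I_mul_add_int])
    rw [exp_two_pi_I_mul_add_int, eq_div_iff hx] at h
    rw [← h]
    have e : x + ((-i - 1 : ℤ) : ℂ) + 1 = x + ((-i : ℤ) : ℂ) := by push_cast; ring
    rw [e, ih, mul_assoc, ← zpow_add_one₀ hx]
    congr 2
    ring

lemma analyticAt_dilogExp_of_abs_re_lt {x : ℂ} (hx : |x.re| < 1) : AnalyticAt ℂ dilogExp x := by
  have hpi := Real.pi_pos
  have hy : Real.pi / 2 ∈ Ioo 0 Real.pi := ⟨half_pos hpi, half_lt_self hpi⟩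
  have hopen : IsOpen {x : ℂ | |x.re| < 1} := isOpen_lt (by fun_prop) continuous_const
  have hd : DifferentiableOn ℂ dilogExp {x : ℂ | |x.re| < 1} := by
    have : DifferentiableOn ℂ (fun x => exp (faddeevLog (Real.pi / 2) x)) {x : ℂ | |x.re| < 1} :=
      fun w hw => (hasDerivAt_faddeevLog_integral hw hy).differentiableAt.cexp.differentiableWithinAt
    exact this.congr fun w hw => by rw [dilogExp, faddeevLog_eq_dilogLog hw hy]
  exact hd.analyticAt (hopen.mem_nhds hx)

/-- Used to carry any point into |Re x| < 1, where E is the exponential of a holomorphic integral;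
this bypasses the branch cuts in the closed form. -/
lemma dilogExp_eq_shift (n : ℤ) {y : ℂ} (hy : 1 - exp (2 * Real.pi * I * y) ≠ 0) :
    dilogExp y = dilogExp (y - n) * (1 - exp (2 * Real.pi * I * y)) ^ (-n) := by
  have e : exp (2 * Real.pi * I * (y - n)) = exp (2 * Real.pi * I * y) := by
    rw [← exp_two_pi_I_mul_add_int (y - n) n, sub_add_cancel]
  have := dilogExp_add_int (x := y - n) (by rwa [e]) n
  rwa [sub_add_cancel, e] at this

lemma analyticAt_dilogExp_sub_round (x : ℂ) :
    AnalyticAt ℂ (fun y => dilogExp (y - (round x.re : ℤ))) x := by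
  have hx : |(x - (round x.re : ℤ)).re| < 1 := by
    rw [sub_re, intCast_re]
    exact (abs_sub_round x.re).trans_lt (by norm_num)
  exact (analyticAt_dilogExp_of_abs_re_lt hx).comp_of_eq (by fun_prop) rfl

lemma analyticAt_one_sub_exp (x : ℂ) :
    AnalyticAt ℂ (fun y => 1 - exp (2 * Real.pi * I * y)) x := by fun_prop

lemma analyticAt_dilogExp {x : ℂ} (hx : 1 - exp (2 * Real.pi * I * x) ≠ 0) :
    AnalyticAt ℂ dilogExp x := by
  refine ((analyticAt_dilogExp_sub_round x).fun_mul
    ((analyticAt_one_sub_exp x).fun_zpow (n := -round x.re) hx)).congr ?_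
  filter_upwards [(analyticAt_one_sub_exp x).continuousAt.eventually_ne hx] with y hy
  exact (dilogExp_eq_shift _ hy).symm

lemma meromorphicAt_dilogExp (x : ℂ) : MeromorphicAt dilogExp x := by
  refine ((analyticAt_dilogExp_sub_round x).meromorphicAt.fun_mul
    ((analyticAt_one_sub_exp x).meromorphicAt.fun_zpow (-round x.re))).congr ?_
  -- The derivative never vanishes, so zeros of 1 - e^{2πiy} are isolated and the shift formula
  -- holds on a punctured neighbourhood.
  have hder : HasDerivAt (fun y => 1 - exp (2 * Real.pi * I * y))
      (-(exp (2 * Real.pi * I * x) * (2 * Real.pi * I))) x := by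
    simpa using (((hasDerivAt_id x).const_mul (2 * Real.pi * I : ℂ)).cexp.const_sub 1)
  filter_upwards [hder.eventually_ne (c := 0)
    (neg_ne_zero.2 (mul_ne_zero (exp_ne_zero _) two_pi_I_ne_zero))] with y hy
  exact (dilogExp_eq_shift _ hy).symm

/-- The closed form of `φ_N`, as a product of quantum dilogarithms at `b = 1`. -/
noncomputable def dilogProd (N : ℕ) (ζ : ℂ) : ℂ :=
  ∏ k ∈ Finset.range N, dilogExp ((ζ - k) / N)

lemma exp_mul_natCast_eq {N : ℕ} (hN : N ≠ 0) (ζ : ℂ) (k : ℤ) :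
    exp (2 * Real.pi * I * ((ζ - k) / N)) ^ N = exp (2 * Real.pi * I * ζ) := by
  have hN' : (N : ℂ) ≠ 0 := Nat.cast_ne_zero.2 hN
  rw [← exp_nat_mul, ← exp_two_pi_I_mul_add_int ζ (-k)]
  congr 1
  push_cast
  field_simp
  ring

lemma one_sub_exp_div_ne_zero {N : ℕ} (hN : N ≠ 0) {ζ : ℂ}
    (hζ : 1 - exp (2 * Real.pi * I * ζ) ≠ 0) (k : ℤ) :
    1 - exp (2 * Real.pi * I * ((ζ - k) / N)) ≠ 0 := fun h => by
  apply hζ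
  rw [← exp_mul_natCast_eq hN ζ k, ← sub_eq_zero.1 h, one_pow, sub_self]

/-- This is exactly the range of ζ for which (ζ-k)/N has real part in (-1, 1) for all 0 ≤ k < N. -/
lemma strip_mem_iff {N : ℕ} (hN : N ≠ 0) (ζ : ℂ) :
    I / sqrtN N * (ζ - ((N : ℂ) - 1) / 2) ∈ strip (sqrtN N) ↔ -1 < ζ.re ∧ ζ.re < N := by
  have hNpos : (0 : ℝ) < N := by exact_mod_cast Nat.pos_of_ne_zero hN
  have hr : 0 < Real.sqrt N := Real.sqrt_pos.2 hNpos
  have h1 : (I / sqrtN N * (ζ - ((N : ℂ) - 1) / 2)).im =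
      (ζ.re - ((N : ℝ) - 1) / 2) / Real.sqrt N := by
    have e : I / sqrtN N * (ζ - ((N : ℂ) - 1) / 2) =
        I * (ζ - (((N : ℝ) - 1) / 2 : ℝ)) / ((Real.sqrt N : ℝ) : ℂ) := by
      rw [sqrtN]; push_cast; ring
    rw [e, div_ofReal_im]
    simp
  have h2 : (cConst (sqrtN N)).im = ((N : ℝ) + 1) / 2 / Real.sqrt N := by
    have e : cConst (sqrtN N) = (((Real.sqrt N + (Real.sqrt N)⁻¹) / 2 : ℝ) : ℂ) * I := by
      rw [cConst, sqrtN]; push_cast; ring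
    rw [e, im_ofReal_mul, I_im, mul_one]
    have := Real.sq_sqrt hNpos.le
    field_simp
    rw [this]
  rw [strip, mem_ofPred_eq, h1, h2, abs_div, abs_div, div_lt_div_iff_of_pos_right (abs_pos.2 hr.ne'),
    abs_of_pos (show (0 : ℝ) < ((N : ℝ) + 1) / 2 by positivity), abs_lt]
  constructor <;> rintro ⟨_, _⟩ <;> constructor <;> linarith

lemma phiN_eq_dilogProd {N : ℕ} (hN : N ≠ 0) {ε : ℝ} (hε : 0 < ε)
    (hε' : ε < Real.pi / Real.sqrt N) {ζ : ℂ} (hζ : 1 - exp (2 * Real.pi * I * ζ) ≠ 0) :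
    phiN ε N ζ = dilogProd N ζ := by
  have hNpos : (0 : ℝ) < N := by exact_mod_cast Nat.pos_of_ne_zero hN
  have hr : 0 < Real.sqrt N := Real.sqrt_pos.2 hNpos
  have hs0 : sqrtN N ≠ 0 := by rw [sqrtN]; exact_mod_cast hr.ne'
  have hN' : (N : ℂ) ≠ 0 := Nat.cast_ne_zero.2 hN
  -- σ inverts the affine map ζ ↦ iζ/√N - c_{√N} + i/√N.
  set σ : ℂ → ℂ := fun z => -I * sqrtN N * z + ((N : ℂ) - 1) / 2 with hσ
  have hσinv : ∀ z, I / sqrtN N * (σ z - ((N : ℂ) - 1) / 2) = z := fun z => by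
    rw [hσ]; field_simp; ring_nf; rw [I_sq]; ring
  have hσinv' : ∀ ζ, σ (I / sqrtN N * (ζ - ((N : ℂ) - 1) / 2)) = ζ := fun ζ => by
    rw [hσ]; field_simp; ring_nf; rw [I_sq]; ring
  have hσan : ∀ k : ℕ, ∀ z, AnalyticAt ℂ (fun z => (σ z - k) / N) z := fun k z => by
    rw [hσ]
    exact ((by fun_prop : AnalyticAt ℂ (fun z : ℂ => -I * sqrtN N * z + ((N : ℂ) - 1) / 2 - k) z)).div_const
  have hy : ε * Real.sqrt N ∈ Ioo 0 Real.pi := ⟨by positivity, (lt_div_iff₀ hr).1 hε'⟩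
  have hre : ∀ {w : ℂ}, -1 < w.re ∧ w.re < N → ∀ k ∈ Finset.range N,
      |((w - k) / N : ℂ).re| < 1 := by
    intro w hw k hk
    have hk' : (k : ℝ) + 1 ≤ N := by exact_mod_cast Finset.mem_range.1 hk
    have hk0 : (0 : ℝ) ≤ k := Nat.cast_nonneg k
    rw [div_natCast_re, sub_re, natCast_re, abs_lt, lt_div_iff₀ hNpos, div_lt_iff₀ hNpos]
    constructor <;> linarith [hw.1, hw.2]
  have hmem : ∀ {z}, z ∈ strip (sqrtN N) → -1 < (σ z).re ∧ (σ z).re < N := fun {z} hz => by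
    rwa [← strip_mem_iff hN, hσinv]
  have hopen : IsOpen (strip (sqrtN N)) :=
    isOpen_lt (continuous_abs.comp continuous_im) continuous_const
  have hne : (strip (sqrtN N)).Nonempty :=
    ⟨_, (strip_mem_iff hN 0).2 ⟨by simp, by simpa using hNpos⟩⟩
  rw [phiN, strip_argument N hN, faddeev]
  have key := meromorphicContinuation_eq_of_analyticAt (f := faddeevIntegral ε (sqrtN N))
    (F₀ := fun z => dilogProd N (σ z)) (z := I / sqrtN N * (ζ - ((N : ℂ) - 1) / 2)) hopen hne
    ?_ ?_ ?_ ?_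
  · rw [key, hσinv']
  · intro z _
    exact MeromorphicAt.fun_prod fun k _ =>
      (meromorphicAt_dilogExp _).comp_analyticAt (hσan k z)
  · intro z hz
    exact Finset.analyticAt_fun_prod _ fun k hk =>
      AnalyticAt.comp (f := fun z => (σ z - k) / N) (g := dilogExp)
        (analyticAt_dilogExp_of_abs_re_lt (hre (hmem hz) k hk)) (hσan k z)
  · intro z hz
    have h := hmem hz
    have := faddeevIntegral_eq_prod N hN hε hε' h.1 h.2
    rw [hσinv] at this
    rw [this]
    exact Finset.prod_congr rfl fun k hk => by
      rw [dilogExp, faddeevLog_eq_dilogLog (hre h k hk) hy]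
  · refine Finset.analyticAt_fun_prod _ fun k _ =>
      AnalyticAt.comp (f := fun z => (σ z - k) / N) (g := dilogExp) ?_ (hσan k _)
    simp only [hσinv']
    exact analyticAt_dilogExp (by simpa using one_sub_exp_div_ne_zero hN hζ k)

/-! ### Powers of ω and the functional equation of φ_N -/

lemma omegaPow_eq (N : ℕ) (x : ℂ) : omegaPow N x = exp (2 * Real.pi * I * (x / N)) := by
  rw [omegaPow, mul_div_assoc]

lemma omegaPow_add (N : ℕ) (x y : ℂ) : omegaPow N (x + y) = omegaPow N x * omegaPow N y := by
  simp only [omegaPow, ← exp_add]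
  ring_nf

lemma omegaPow_natCast_mul (N : ℕ) (k : ℕ) (x : ℂ) : omegaPow N (k * x) = omegaPow N x ^ k := by
  rw [omegaPow, omegaPow, ← exp_nat_mul]
  ring_nf

lemma omegaPow_ne_zero (N : ℕ) (x : ℂ) : omegaPow N x ≠ 0 := exp_ne_zero _

lemma one_sub_omegaPow_ne_zero {N : ℕ} (hN : N ≠ 0) {ζ : ℂ}
    (hζ : 1 - exp (2 * Real.pi * I * ζ) ≠ 0) (k : ℤ) : 1 - omegaPow N (ζ + k) ≠ 0 := by
  have := one_sub_exp_div_ne_zero hN hζ (-k)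
  rwa [← omegaPow_eq, Int.cast_neg, sub_neg_eq_add] at this

lemma omegaPow_sub_natCast {N : ℕ} (hN : N ≠ 0) (x : ℂ) : omegaPow N (x - N) = omegaPow N x := by
  have hN' : (N : ℂ) ≠ 0 := Nat.cast_ne_zero.2 hN
  have h := exp_two_pi_I_mul_add_int (x / N) (-1)
  rw [omegaPow_eq, omegaPow_eq, ← h, sub_div, div_self hN']
  push_cast
  rw [sub_eq_add_neg]

lemma isPrimitiveRoot_omegaPow_neg_one {N : ℕ} (hN : N ≠ 0) :
    IsPrimitiveRoot (omegaPow N (-1)) N := by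
  have h := (isPrimitiveRoot_exp N hN).inv
  rw [← exp_neg] at h
  have e : omegaPow N (-1) = exp (-(2 * Real.pi * I / N)) := by
    rw [omegaPow]
    ring_nf
  rwa [e]

lemma prod_one_sub_omegaPow {N : ℕ} (hN : N ≠ 0) (ζ : ℂ) :
    ∏ k ∈ Finset.range N, (1 - omegaPow N (ζ - k)) = 1 - exp (2 * Real.pi * I * ζ) := by
  have hN' : (N : ℂ) ≠ 0 := Nat.cast_ne_zero.2 hN
  have hα : omegaPow N ζ ^ N = exp (2 * Real.pi * I * ζ) := by
    rw [← omegaPow_natCast_mul, omegaPow]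
    congr 1
    field_simp
  have h := congrArg (Polynomial.eval 1) (X_pow_sub_C_eq_prod (isPrimitiveRoot_omegaPow_neg_one hN)
    (Nat.pos_of_ne_zero hN) hα)
  simp only [Polynomial.eval_prod, Polynomial.eval_sub, Polynomial.eval_pow, Polynomial.eval_X,
    Polynomial.eval_C, one_pow] at h
  rw [h]
  refine Finset.prod_congr rfl fun k _ => ?_
  rw [← omegaPow_natCast_mul, ← omegaPow_add]
  ring_nf

lemma hasDerivAt_one_sub_omegaPow (N : ℕ) (c x : ℂ) :
    HasDerivAt (fun x => 1 - omegaPow N (x - c))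
      (-(omegaPow N (x - c) * (2 * Real.pi * I / N))) x := by
  unfold omegaPow
  have := (((((hasDerivAt_id x).sub_const c).const_mul (2 * Real.pi * I : ℂ)).div_const
    (N : ℂ)).cexp.const_sub 1)
  simpa using this

/-- Logarithmic derivative of the factorization `prod_one_sub_omegaPow`. -/
lemma sum_omegaPow_div {N : ℕ} (hN : N ≠ 0) {ζ : ℂ}
    (hζ : 1 - exp (2 * Real.pi * I * ζ) ≠ 0) :
    ∑ k ∈ Finset.range N, omegaPow N (ζ - k) / (1 - omegaPow N (ζ - k)) =
      N * (exp (2 * Real.pi * I * ζ) / (1 - exp (2 * Real.pi * I * ζ))) := by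
  have hN' : (N : ℂ) ≠ 0 := Nat.cast_ne_zero.2 hN
  have hne : ∀ k ∈ Finset.range N, 1 - omegaPow N (ζ - k) ≠ 0 := fun k _ => by
    simpa [sub_eq_add_neg] using one_sub_omegaPow_ne_zero hN hζ (-k)
  have h := logDeriv_prod (f := fun (k : ℕ) (x : ℂ) => 1 - omegaPow N (x - k)) hne
    (fun k _ => (hasDerivAt_one_sub_omegaPow N k ζ).differentiableAt)
  simp only [prod_one_sub_omegaPow hN] at h
  have hder : HasDerivAt (fun y => 1 - exp (2 * Real.pi * I * y))
      (-(exp (2 * Real.pi * I * ζ) * (2 * Real.pi * I))) ζ := by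
    simpa using (((hasDerivAt_id ζ).const_mul (2 * Real.pi * I : ℂ)).cexp.const_sub 1)
  simp only [logDeriv_apply, hder.deriv, (hasDerivAt_one_sub_omegaPow N _ ζ).deriv] at h
  have hpi : (2 * Real.pi * I : ℂ) ≠ 0 := two_pi_I_ne_zero
  have hfac : ∀ k ∈ Finset.range N, -(omegaPow N (ζ - k) * (2 * Real.pi * I / N)) /
      (1 - omegaPow N (ζ - k)) =
      (-(2 * Real.pi * I) / N) * (omegaPow N (ζ - k) / (1 - omegaPow N (ζ - k))) :=
    fun k _ => by ring
  rw [Finset.sum_congr rfl hfac, ← Finset.mul_sum] at h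
  have e : -(exp (2 * Real.pi * I * ζ) * (2 * Real.pi * I)) / (1 - exp (2 * Real.pi * I * ζ)) =
      (-(2 * Real.pi * I) / N) *
        (N * (exp (2 * Real.pi * I * ζ) / (1 - exp (2 * Real.pi * I * ζ)))) := by
    field_simp
  rw [e] at h
  exact (mul_left_cancel₀ (div_ne_zero (neg_ne_zero.2 hpi) hN') h).symm

/-- The shift moves each factor to its neighbour; only the factor k = N-1 is replaced, its argument
growing by 1, and ω^{ζ-(N-1)} = ω^{ζ+1}. -/
lemma dilogProd_add_one {N : ℕ} (hN : N ≠ 0) {ζ : ℂ} (hζ : 1 - exp (2 * Real.pi * I * ζ) ≠ 0) :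
    dilogProd N (ζ + 1) = dilogProd N ζ / (1 - omegaPow N (ζ + 1)) := by
  obtain ⟨M, rfl⟩ := Nat.exists_eq_succ_of_ne_zero hN
  have hN' : ((M.succ : ℕ) : ℂ) ≠ 0 := Nat.cast_ne_zero.2 hN
  rw [dilogProd, dilogProd, Finset.prod_range_succ', Finset.prod_range_succ, mul_div_assoc]
  congr 1
  · refine Finset.prod_congr rfl fun k _ => ?_
    congr 1
    push_cast
    ring
  · have h := dilogExp_add_one (x := (ζ - M) / (M.succ : ℕ))
      (by simpa using one_sub_exp_div_ne_zero hN hζ M)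
    have e1 : (ζ - M) / (M.succ : ℕ) + 1 = (ζ + 1 - (0 : ℕ)) / (M.succ : ℕ) := by
      field_simp
      push_cast
      ring
    have e2 : omegaPow M.succ (ζ - M) = omegaPow M.succ (ζ + 1) := by
      rw [← omegaPow_sub_natCast hN (ζ + 1)]
      push_cast
      ring_nf
    rw [e1, ← omegaPow_eq, e2] at h
    exact h

/-! ### The N-th power of φ_N -/

lemma one_sub_omegaPow_mem_slitPlane {N k : ℕ} (hk : 1 ≤ k) (hkN : k < N) {x : ℂ}
    (hx : |x.re| < 1) : 1 - omegaPow N (x - k) ∈ slitPlane := by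
  have hNpos : (0 : ℝ) < N := by exact_mod_cast (Nat.zero_le k).trans_lt hkN
  have hk' : (1 : ℝ) ≤ k := by exact_mod_cast hk
  have hkN' : (k : ℝ) + 1 ≤ N := by exact_mod_cast hkN
  obtain ⟨hx1, hx2⟩ := abs_lt.1 hx
  set w : ℂ := (x - k) / N with hw
  have hre : w.re = (x.re - k) / N := by rw [hw, div_natCast_re, sub_re, natCast_re]
  have hw1 : |w.re| < 1 := by
    rw [hre, abs_lt, lt_div_iff₀ hNpos, div_lt_iff₀ hNpos]
    constructor <;> linarith
  -- Re w lies in (-1, 0), so ω^{x-k} is never a positive real and the cut is avoided.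
  have hw0 : w.re ≠ 0 := by
    rw [hre]
    exact div_ne_zero (by linarith) hNpos.ne'
  have hline : w = (w.re : ℂ) - I * ((-w.im : ℝ) : ℂ) := by
    apply Complex.ext <;> simp
  rw [omegaPow_eq, ← hw, hline, exp_two_pi_I_mul_sub]
  have hne1 : exp (2 * Real.pi * I * w) ≠ 1 := fun h =>
    one_sub_exp_ne_zero hw1 (fun h0 => hw0 (by rw [h0, zero_re])) (by rw [h, sub_self])
  have hne2 : exp (2 * Real.pi * I * (w.re : ℂ)) ≠ 1 := fun h =>
    one_sub_exp_ne_zero (x := (w.re : ℂ)) (by simpa using hw1) (by exact_mod_cast hw0)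
      (by rw [h, sub_self])
  rw [hline, exp_two_pi_I_mul_sub] at hne1
  rcases one_sub_mem_slitPlane_or (norm_exp_two_pi_I_mul w.re) (Real.exp_pos _) hne1 with h | h
  · exact h
  · exact absurd h.1 hne2

/-- The difference of the logarithms of the two sides of `dilogProd_pow`. -/
noncomputable def dilogDefect (N : ℕ) (x : ℂ) : ℂ :=
  N * ∑ k ∈ Finset.range N, faddeevLog (Real.pi / 2) ((x - k) / N) - faddeevLog (Real.pi / 2) x -
    ∑ k ∈ Finset.range N, (k : ℂ) * log (1 - omegaPow N (x - k))

lemma pi_div_two_mem : Real.pi / 2 ∈ Ioo 0 Real.pi :=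
  ⟨half_pos Real.pi_pos, half_lt_self Real.pi_pos⟩

lemma abs_re_sub_div_lt_one {N k : ℕ} (hk : k < N) {x : ℂ} (hx : |x.re| < 1) :
    |((x - k) / N : ℂ).re| < 1 := by
  have hNpos : (0 : ℝ) < N := by exact_mod_cast (Nat.zero_le k).trans_lt hk
  have hk' : (k : ℝ) + 1 ≤ N := by exact_mod_cast hk
  have hk0 : (0 : ℝ) ≤ k := Nat.cast_nonneg k
  obtain ⟨hx1, hx2⟩ := abs_lt.1 hx
  rw [div_natCast_re, sub_re, natCast_re, abs_lt, lt_div_iff₀ hNpos, div_lt_iff₀ hNpos]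
  constructor <;> linarith

lemma hasDerivAt_mul_log_one_sub_omegaPow {N k : ℕ} (hkN : k < N) {x : ℂ} (hx : |x.re| < 1) :
    HasDerivAt (fun x => (k : ℂ) * log (1 - omegaPow N (x - k)))
      (k * (-(omegaPow N (x - k) * (2 * Real.pi * I / N)) / (1 - omegaPow N (x - k)))) x := by
  -- At k = 0 the logarithm may meet its cut, but its weight is 0.
  rcases Nat.eq_zero_or_pos k with rfl | hk
  · simpa using hasDerivAt_const x (0 : ℂ)
  · exact ((hasDerivAt_one_sub_omegaPow N k x).clog
      (one_sub_omegaPow_mem_slitPlane hk hkN hx)).const_mul _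

lemma hasDerivAt_sub_div (N k : ℕ) (x : ℂ) :
    HasDerivAt (fun x : ℂ => (x - k) / N) (1 / N) x :=
  ((hasDerivAt_id x).sub_const _).div_const _

lemma continuousAt_dilogDefect (N : ℕ) {x : ℂ} (hx : |x.re| < 1) :
    ContinuousAt (dilogDefect N) x := by
  unfold dilogDefect
  refine (ContinuousAt.sub (continuousAt_const.mul ?_)
    (hasDerivAt_faddeevLog_integral hx pi_div_two_mem).continuousAt).sub ?_
  · refine tendsto_finsetSum _ fun k hk => ?_
    exact ContinuousAt.comp (g := faddeevLog (Real.pi / 2)) (f := fun x : ℂ => (x - k) / N)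
      (hasDerivAt_faddeevLog_integral (abs_re_sub_div_lt_one (Finset.mem_range.1 hk) hx)
        pi_div_two_mem).continuousAt (hasDerivAt_sub_div N k x).continuousAt
  · exact tendsto_finsetSum _ fun k hk =>
      (hasDerivAt_mul_log_one_sub_omegaPow (Finset.mem_range.1 hk) hx).continuousAt

/-- The weights k on the logarithms turn the coefficients x - k into x; the sum is then given by
`sum_omegaPow_div`. -/
lemma hasDerivAt_dilogDefect {N : ℕ} (hN : N ≠ 0) {x : ℂ} (hx : |x.re| < 1) (hx0 : x ≠ 0) :
    HasDerivAt (dilogDefect N) 0 x := by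
  have hN' : (N : ℂ) ≠ 0 := Nat.cast_ne_zero.2 hN
  have hz := one_sub_exp_ne_zero hx hx0
  have h1 : ∀ k ∈ Finset.range N, HasDerivAt
      (fun x : ℂ => faddeevLog (Real.pi / 2) ((x - k) / N))
      (2 * Real.pi * I * ((x - k) / N) * omegaPow N (x - k) / (1 - omegaPow N (x - k)) *
        (1 / N)) x := by
    intro k hk
    have hne : (x - k) / N ≠ 0 := fun h0 => by
      have := one_sub_exp_div_ne_zero hN hz k
      rw [Int.cast_natCast, h0] at this
      simp at this
    have := hasDerivAt_faddeevLog (abs_re_sub_div_lt_one (Finset.mem_range.1 hk) hx) hne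
      pi_div_two_mem
    rw [← omegaPow_eq] at this
    exact this.comp x (hasDerivAt_sub_div N k x)
  have h := (((HasDerivAt.fun_sum h1).const_mul (N : ℂ)).sub
    (hasDerivAt_faddeevLog hx hx0 pi_div_two_mem)).sub
    (HasDerivAt.fun_sum fun k (hk : k ∈ Finset.range N) =>
      hasDerivAt_mul_log_one_sub_omegaPow (Finset.mem_range.1 hk) hx)
  refine h.congr_deriv ?_
  have hsum := sum_omegaPow_div hN hz
  have e : ∀ k ∈ Finset.range N,
      N * (2 * Real.pi * I * ((x - k) / N) * omegaPow N (x - k) / (1 - omegaPow N (x - k)) *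
        (1 / N)) - k * (-(omegaPow N (x - k) * (2 * Real.pi * I / N)) / (1 - omegaPow N (x - k))) =
      2 * Real.pi * I * x / N * (omegaPow N (x - k) / (1 - omegaPow N (x - k))) := by
    intro k _
    field_simp
    ring
  rw [Finset.mul_sum, sub_right_comm, ← Finset.sum_sub_distrib, Finset.sum_congr rfl e,
    ← Finset.mul_sum, hsum]
  field_simp
  ring

lemma tendsto_dilogDefect (N : ℕ) (hN : N ≠ 0) {θ : ℝ} (hθ : |θ| < 1) :
    Tendsto (fun y : ℝ => dilogDefect N (θ - I * y)) atBot (𝓝 0) := by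
  have hNpos : (0 : ℝ) < N := by exact_mod_cast Nat.pos_of_ne_zero hN
  have hdiv : Tendsto (fun y : ℝ => y / N) atBot atBot := tendsto_id.atBot_div_const hNpos
  have hline : ∀ (k : ℕ) (y : ℝ), ((θ : ℂ) - I * y - k) / N =
      (((θ - k) / N : ℝ) : ℂ) - I * ((y / N : ℝ) : ℂ) := fun k y => by push_cast; ring
  have h1 : ∀ k ∈ Finset.range N, Tendsto
      (fun y : ℝ => faddeevLog (Real.pi / 2) (((θ : ℂ) - I * y - k) / N)) atBot (𝓝 0) := by
    intro k hk
    have hre : |(θ - k) / N| < 1 := by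
      have := abs_re_sub_div_lt_one (Finset.mem_range.1 hk) (x := (θ : ℂ)) (by simpa using hθ)
      rwa [div_natCast_re, sub_re, natCast_re, ofReal_re] at this
    simp only [hline]
    exact (tendsto_faddeevLog hre pi_div_two_mem).comp hdiv
  have h2 : ∀ k ∈ Finset.range N, Tendsto
      (fun y : ℝ => (k : ℂ) * log (1 - omegaPow N ((θ : ℂ) - I * y - k))) atBot (𝓝 0) := by
    intro k _
    simp only [omegaPow_eq, hline, exp_two_pi_I_mul_sub]
    have hr : Tendsto (fun y : ℝ => ((Real.exp (2 * Real.pi * (y / N)) : ℝ) : ℂ)) atBot (𝓝 0) := by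
      have := (continuous_ofReal.tendsto 0).comp
        (Real.tendsto_exp_atBot.comp (hdiv.const_mul_atBot Real.two_pi_pos))
      simpa [Function.comp_def] using this
    have h3 := ((hr.mul_const (exp (2 * Real.pi * I * ((θ - k) / N : ℝ)))).const_sub 1)
    rw [zero_mul, sub_zero] at h3
    have h4 := (h3.clog one_mem_slitPlane).const_mul (k : ℂ)
    rwa [log_one, mul_zero] at h4
  have h := (((tendsto_finsetSum _ h1).const_mul (N : ℂ)).sub
    (tendsto_faddeevLog hθ pi_div_two_mem)).sub (tendsto_finsetSum _ h2)
  simpa [dilogDefect] using h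

lemma dilogDefect_eq_zero {N : ℕ} (hN : N ≠ 0) {x : ℂ} (hx : |x.re| < 1) :
    dilogDefect N x = 0 := by
  set θ := x.re
  have hline : x = (θ : ℂ) - I * ((-x.im : ℝ) : ℂ) := by
    apply Complex.ext <;> simp [θ]
  have hre : ∀ v : ℝ, |((θ : ℂ) - I * v).re| < 1 := fun v => by simpa using hx
  have hcont : Continuous fun v : ℝ => dilogDefect N ((θ : ℂ) - I * v) := by
    rw [continuous_iff_continuousAt]
    exact fun v => ContinuousAt.comp (g := dilogDefect N) (continuousAt_dilogDefect N (hre v))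
      (hasDerivAt_line θ v).continuousAt
  have hder : ∀ v ≠ 0, HasDerivAt (fun v : ℝ => dilogDefect N ((θ : ℂ) - I * v)) 0 v := by
    intro v hv
    have h := (hasDerivAt_dilogDefect hN (hre v) (line_ne_zero θ hv)).comp v (hasDerivAt_line θ v)
    rwa [zero_mul] at h
  have := eq_zero_of_hasDerivAt_zero_off_zero hcont hder (tendsto_dilogDefect N hN hx) (-x.im)
  rwa [← hline] at this

lemma dilogProd_pow_of_abs_re_lt {N : ℕ} (hN : N ≠ 0) {ζ : ℂ}
    (hζ : 1 - exp (2 * Real.pi * I * ζ) ≠ 0) (hre : |ζ.re| < 1) :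
    dilogProd N ζ ^ N =
      dilogExp ζ * ∏ k ∈ Finset.range N, (1 - omegaPow N (ζ - k)) ^ k := by
  have h := dilogDefect_eq_zero hN hre
  have hne : ∀ k ∈ Finset.range N, 1 - omegaPow N (ζ - k) ≠ 0 := fun k _ => by
    simpa [sub_eq_add_neg] using one_sub_omegaPow_ne_zero hN hζ (-k)
  have h1 : ∏ k ∈ Finset.range N, (1 - omegaPow N (ζ - k)) ^ k =
      exp (∑ k ∈ Finset.range N, (k : ℂ) * log (1 - omegaPow N (ζ - k))) := by
    rw [exp_sum]
    exact Finset.prod_congr rfl fun k hk => by rw [exp_nat_mul, exp_log (hne k hk)]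
  have h2 : dilogProd N ζ =
      exp (∑ k ∈ Finset.range N, faddeevLog (Real.pi / 2) ((ζ - k) / N)) := by
    rw [exp_sum]
    exact Finset.prod_congr rfl fun k hk => by
      rw [dilogExp, faddeevLog_eq_dilogLog (abs_re_sub_div_lt_one (Finset.mem_range.1 hk) hre)
        pi_div_two_mem]
  rw [h1, h2, dilogExp, ← faddeevLog_eq_dilogLog hre pi_div_two_mem, ← exp_nat_mul, ← exp_add]
  congr 1
  rw [dilogDefect] at h
  linear_combination h

/-- After reindexing every exponent k becomes k+1; the top factor comes from (1 - ω^{ζ+1})^N. -/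
lemma prod_one_sub_omegaPow_pow_add_one {N : ℕ} (hN : N ≠ 0) (ζ : ℂ) :
    (∏ k ∈ Finset.range N, (1 - omegaPow N (ζ + 1 - k)) ^ k) * (1 - omegaPow N (ζ + 1)) ^ N =
      (∏ k ∈ Finset.range N, (1 - omegaPow N (ζ - k)) ^ k) *
        (1 - exp (2 * Real.pi * I * ζ)) := by
  rw [← prod_one_sub_omegaPow hN, ← Finset.prod_mul_distrib]
  obtain ⟨M, rfl⟩ := Nat.exists_eq_succ_of_ne_zero hN
  rw [Finset.prod_range_succ', Finset.prod_range_succ, pow_zero, mul_one]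
  congr 1
  · refine Finset.prod_congr rfl fun k _ => ?_
    rw [← pow_succ]
    congr 3
    push_cast
    ring
  · rw [← pow_succ, ← omegaPow_sub_natCast hN (ζ + 1)]
    congr 3
    push_cast
    ring

lemma dilogProd_pow_add_one_iff {N : ℕ} (hN : N ≠ 0) {ζ : ℂ}
    (hζ : 1 - exp (2 * Real.pi * I * ζ) ≠ 0) :
    dilogProd N (ζ + 1) ^ N =
      dilogExp (ζ + 1) * ∏ k ∈ Finset.range N, (1 - omegaPow N (ζ + 1 - k)) ^ k ↔
    dilogProd N ζ ^ N =
      dilogExp ζ * ∏ k ∈ Finset.range N, (1 - omegaPow N (ζ - k)) ^ k := by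
  have h1 : 1 - omegaPow N (ζ + 1) ≠ 0 := by simpa using one_sub_omegaPow_ne_zero hN hζ 1
  have h2 := prod_one_sub_omegaPow_pow_add_one hN ζ
  rw [dilogProd_add_one hN hζ, dilogExp_add_one hζ, div_pow, div_eq_iff (pow_ne_zero N h1),
    mul_assoc, h2, div_mul_eq_mul_div, mul_comm (∏ k ∈ Finset.range N, _) (1 - exp _),
    mul_left_comm, mul_div_cancel_left₀ _ hζ]

/-- Both sides obey the same functional equation under ζ ↦ ζ+1, so the case |Re ζ| < 1 propagates by
integer translations. -/
lemma dilogProd_pow {N : ℕ} (hN : N ≠ 0) {ζ : ℂ} (hζ : 1 - exp (2 * Real.pi * I * ζ) ≠ 0) :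
    dilogProd N ζ ^ N =
      dilogExp ζ * ∏ k ∈ Finset.range N, (1 - omegaPow N (ζ - k)) ^ k := by
  have hshift : ∀ n : ℤ, ∀ ξ : ℂ, 1 - exp (2 * Real.pi * I * ξ) ≠ 0 → |ξ.re| < 1 →
      dilogProd N (ξ + n) ^ N =
        dilogExp (ξ + n) * ∏ k ∈ Finset.range N, (1 - omegaPow N (ξ + n - k)) ^ k := by
    intro n ξ hξ hre
    induction n using Int.induction_on with
    | zero => simpa using dilogProd_pow_of_abs_re_lt hN hξ hre
    | succ i ih =>
      have := (dilogProd_pow_add_one_iff hN (ζ := ξ + (i : ℤ))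
        (by rwa [exp_two_pi_I_mul_add_int])).2 ih
      rw [add_assoc] at this
      exact_mod_cast this
    | pred i ih =>
      refine (dilogProd_pow_add_one_iff hN (by rwa [exp_two_pi_I_mul_add_int])).1 ?_
      have e : ξ + ((-i - 1 : ℤ) : ℂ) + 1 = ξ + ((-i : ℤ) : ℂ) := by push_cast; ring
      rw [e]
      exact ih
  have h := hshift (round ζ.re) (ζ - (round ζ.re : ℤ)) ?_ ?_
  · rwa [sub_add_cancel] at h
  · rwa [← exp_two_pi_I_mul_add_int _ (round ζ.re), sub_add_cancel]
  · rw [sub_re, intCast_re]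
    exact (abs_sub_round ζ.re).trans_lt (by norm_num)

/-! ### A determinant of Vandermonde type -/

lemma prod_prod_range_eq {M : Type*} [CommMonoid M] (f : ℕ → M) (n : ℕ) :
    ∏ j ∈ Finset.range n, ∏ l ∈ Finset.range j, f l = ∏ l ∈ Finset.range n, f l ^ (n - 1 - l) := by
  induction n with
  | zero => simp
  | succ n ih =>
    rw [Finset.prod_range_succ, ih, Finset.prod_range_succ, Nat.add_sub_cancel, Nat.sub_self,
      pow_zero, mul_one, ← Finset.prod_mul_distrib]
    refine Finset.prod_congr rfl fun l hl => ?_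
    rw [← pow_succ]
    congr 1
    have := Finset.mem_range.1 hl
    omega

lemma prod_fin_prod_range_rev {M : Type*} [CommMonoid M] (f : ℕ → M) (n : ℕ) :
    ∏ i : Fin n, ∏ l ∈ Finset.range (n - 1 - i), f l =
      ∏ l ∈ Finset.range n, f l ^ (n - 1 - l) := by
  rw [Fin.prod_univ_eq_prod_range (fun i => ∏ l ∈ Finset.range (n - 1 - i), f l) n,
    Finset.prod_range_reflect (fun j => ∏ l ∈ Finset.range j, f l) n, prod_prod_range_eq]

/-- Row i is a polynomial of degree n-1-i in u j with leading coefficient ∏(-c). Dividing these out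
and reversing the rows leaves monic polynomials of degrees 0, …, n-1. -/
lemma det_prod_one_sub_eq_vandermonde {K : Type*} [Field K] {n : ℕ} (c : ℕ → K)
    (hc : ∀ i, c i ≠ 0) (u : Fin n → K) :
    (Matrix.of fun i j : Fin n => ∏ l ∈ Finset.range (n - 1 - i), (1 - c (i + 1 + l) * u j)).det =
      (Equiv.Perm.sign (Fin.revPerm : Equiv.Perm (Fin n)) : K) *
        ((∏ i : Fin n, ∏ l ∈ Finset.range (n - 1 - i), -c (i + 1 + l)) *
          (Matrix.vandermonde u).det) := by
  -- The index n - i + l becomes i + 1 + l once i is replaced by n - 1 - i.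
  set p : Fin n → Polynomial K := fun i =>
    ∏ l ∈ Finset.range i, (Polynomial.X - Polynomial.C (c (n - i + l))⁻¹) with hp
  have hmonic : ∀ i, (p i).Monic := fun i =>
    Polynomial.monic_prod_of_monic _ _ fun l _ => Polynomial.monic_X_sub_C _
  have hdeg : ∀ i, (p i).natDegree = i := fun i => by
    rw [hp, Polynomial.natDegree_prod_of_monic _ _ fun l _ => Polynomial.monic_X_sub_C _]
    simp
  rw [Matrix.det_eval_matrixOfPolynomials_eq_det_vandermonde u p hdeg hmonic,
    ← Matrix.det_transpose (Matrix.of fun i j => (p j).eval (u i)), mul_left_comm,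
    ← Matrix.det_permute, ← Matrix.det_mul_column]
  congr 1
  ext i j
  have hrev : ((Fin.revPerm i : Fin n) : ℕ) = n - 1 - i := by
    rw [Fin.revPerm_apply, Fin.val_rev]
    omega
  simp only [Matrix.of_apply, Matrix.submatrix_apply, Matrix.transpose_apply, id, hp,
    Polynomial.eval_prod, Polynomial.eval_sub, Polynomial.eval_X, Polynomial.eval_C, hrev]
  rw [← Finset.prod_mul_distrib]
  refine Finset.prod_congr rfl fun l _ => ?_
  have e : n - (n - 1 - (i : ℕ)) + l = i + 1 + l := by
    have := i.2
    omega
  rw [e]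
  have := hc (i + 1 + l)
  field_simp
  ring

/-- By the Vandermonde form, a enters only through leading coefficients, once per factor. At a = 1
an entry with i < j contains the vanishing factor l = j - i - 1, so the matrix is lower triangular.
-/
lemma det_prod_one_sub_pow {K : Type*} [Field K] (n : ℕ) {q a : K} (hq : q ≠ 0) (ha : a ≠ 0) :
    (Matrix.of fun i j : Fin n =>
      ∏ l ∈ Finset.range (n - 1 - i), (1 - q ^ ((i : ℕ) + 1 + l) * a * (q ^ (j : ℕ))⁻¹)).det =
      a ^ (∑ i ∈ Finset.range n, i) *
        ∏ l ∈ Finset.range n, (1 - q ^ (l + 1)) ^ (n - 1 - l) := by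
  have h1 := det_prod_one_sub_eq_vandermonde (fun i => q ^ i * a)
    (fun i => mul_ne_zero (pow_ne_zero i hq) ha) (fun j : Fin n => (q ^ (j : ℕ))⁻¹)
  have h2 := det_prod_one_sub_eq_vandermonde (fun i => q ^ i) (fun i => pow_ne_zero i hq)
    (fun j : Fin n => (q ^ (j : ℕ))⁻¹)
  have h3 : ∏ i : Fin n, ∏ l ∈ Finset.range (n - 1 - i), -(q ^ ((i : ℕ) + 1 + l) * a) =
      a ^ (∑ i ∈ Finset.range n, i) *
        ∏ i : Fin n, ∏ l ∈ Finset.range (n - 1 - i), -q ^ ((i : ℕ) + 1 + l) := by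
    rw [← Finset.sum_range_reflect, ← Fin.sum_univ_eq_sum_range (fun i => n - 1 - i),
      ← Finset.prod_pow_eq_pow_sum, ← Finset.prod_mul_distrib]
    refine Finset.prod_congr rfl fun i _ => ?_
    conv_rhs => rw [← Finset.card_range (n - 1 - (i : ℕ)), ← Finset.prod_const,
      Finset.card_range, ← Finset.prod_mul_distrib]
    exact Finset.prod_congr rfl fun l _ => by ring
  have h4 : (Matrix.of fun i j : Fin n =>
      ∏ l ∈ Finset.range (n - 1 - i), (1 - q ^ ((i : ℕ) + 1 + l) * (q ^ (j : ℕ))⁻¹)).det =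
      ∏ l ∈ Finset.range n, (1 - q ^ (l + 1)) ^ (n - 1 - l) := by
    rw [Matrix.det_of_isLowerTriangular, ← prod_fin_prod_range_rev]
    · refine Finset.prod_congr rfl fun i _ => ?_
      rw [Matrix.of_apply]
      refine Finset.prod_congr rfl fun l _ => ?_
      rw [add_assoc, pow_add, mul_right_comm, mul_inv_cancel₀ (pow_ne_zero _ hq), one_mul,
        add_comm]
    · intro i j hij
      have hij' : (i : ℕ) < j := hij
      have hj := j.2
      refine Finset.prod_eq_zero (i := (j : ℕ) - i - 1) (Finset.mem_range.2 (by omega)) ?_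
      have e : (i : ℕ) + 1 + (j - i - 1) = j := by omega
      rw [e, mul_inv_cancel₀ (pow_ne_zero _ hq), sub_self]
  rw [h1, h3, ← h4, h2]
  ring

/-! ### Products of φ_N over a period, and D(0) -/

lemma omegaPow_natCast (N k : ℕ) : omegaPow N k = omegaPow N 1 ^ k := by
  rw [← omegaPow_natCast_mul, mul_one]

lemma dilogProd_add_natCast {N : ℕ} (hN : N ≠ 0) {ζ : ℂ}
    (hζ : 1 - exp (2 * Real.pi * I * ζ) ≠ 0) (m : ℤ) (d : ℕ) :
    dilogProd N (ζ + m) =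
      dilogProd N (ζ + m + d) * ∏ l ∈ Finset.range d, (1 - omegaPow N (ζ + m + 1 + l)) := by
  induction d with
  | zero => simp
  | succ d ih =>
    have hm : 1 - exp (2 * Real.pi * I * (ζ + (m + d : ℤ))) ≠ 0 := by
      rwa [exp_two_pi_I_mul_add_int]
    have h := dilogProd_add_one hN hm
    have hne := one_sub_omegaPow_ne_zero hN hm 1
    push_cast at h hne
    rw [eq_div_iff hne] at h
    rw [ih, Finset.prod_range_succ]
    push_cast
    have e1 : ζ + (m + d) + 1 = ζ + m + (d + 1) := by ring
    have e2 : ζ + (m + d) = ζ + m + d := by ring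
    have e3 : ζ + m + 1 + d = ζ + m + (d + 1) := by ring
    rw [e1, e2] at h
    rw [e3, ← h]
    ring

/-- Expressing φ_N(ζ) through each φ_N(ζ+j) and multiplying over j gives φ_N(ζ)^N; the correction
factors are those of `dilogProd_pow` and cancel. -/
lemma prod_dilogProd {N : ℕ} (hN : N ≠ 0) {ζ : ℂ} (hζ : 1 - exp (2 * Real.pi * I * ζ) ≠ 0) :
    ∏ j ∈ Finset.range N, dilogProd N (ζ + j) = dilogExp ζ := by
  have h1 : (∏ j ∈ Finset.range N, dilogProd N (ζ + j)) *
      ∏ j ∈ Finset.range N, ∏ l ∈ Finset.range j, (1 - omegaPow N (ζ + 1 + l)) =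
      dilogProd N ζ ^ N := by
    rw [← Finset.prod_mul_distrib]
    conv_rhs => rw [← Finset.card_range N, ← Finset.prod_const, Finset.card_range]
    refine Finset.prod_congr rfl fun j _ => ?_
    simpa using (dilogProd_add_natCast hN hζ 0 j).symm
  have h2 : ∏ j ∈ Finset.range N, ∏ l ∈ Finset.range j, (1 - omegaPow N (ζ + 1 + l)) =
      ∏ k ∈ Finset.range N, (1 - omegaPow N (ζ - k)) ^ k := by
    rw [prod_prod_range_eq, ← Finset.prod_range_reflect]
    refine Finset.prod_congr rfl fun k hk => ?_
    have hk' := Finset.mem_range.1 hk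
    have e1 : N - 1 - (N - 1 - k) = k := by omega
    have e2 : ((N - 1 - k : ℕ) : ℂ) = N - 1 - k := by
      rw [Nat.cast_sub (by omega), Nat.cast_sub (by omega), Nat.cast_one]
    rw [e1, e2, ← omegaPow_sub_natCast hN (ζ + 1 + _)]
    ring_nf
  have hne : ∏ k ∈ Finset.range N, (1 - omegaPow N (ζ - k)) ^ k ≠ 0 :=
    Finset.prod_ne_zero_iff.2 fun k _ => pow_ne_zero _ (by
      simpa [sub_eq_add_neg] using one_sub_omegaPow_ne_zero hN hζ (-k))
  rw [h2, dilogProd_pow hN hζ] at h1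
  exact mul_right_cancel₀ hne h1

/-- The exponents N-1-l and l+1 add up to N, and ∏_{0<k<N} (1 - ω^k) = N. -/
lemma prod_one_sub_omegaPow_mul_bigD {N : ℕ} (hN : N ≠ 0) :
    (∏ l ∈ Finset.range N, (1 - omegaPow N 1 ^ (l + 1)) ^ (N - 1 - l)) * bigD N 0 ^ N =
      (N : ℂ) ^ N := by
  have hN' : (N : ℂ) ≠ 0 := Nat.cast_ne_zero.2 hN
  have hprim : IsPrimitiveRoot (omegaPow N 1) N := by
    have := isPrimitiveRoot_exp N hN
    rwa [← mul_one (2 * Real.pi * I : ℂ)] at this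
  have hD : bigD N 0 ^ N = ∏ l ∈ Finset.range (N - 1), (1 - omegaPow N 1 ^ (l + 1)) ^ (l + 1) := by
    rw [bigD, ← exp_nat_mul, ← mul_assoc, mul_one_div_cancel hN', one_mul, exp_sum,
      Finset.range_eq_Ico, Finset.prod_Ico_add' (fun l => (1 - omegaPow N 1 ^ l) ^ l),
      zero_add, Nat.sub_add_cancel (Nat.pos_of_ne_zero hN)]
    refine Finset.prod_congr (by ext; simp; omega) fun k hk => ?_
    have hk' := Finset.mem_Ico.1 hk
    rw [zero_add, omegaPow_natCast, exp_nat_mul, exp_log]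
    exact sub_ne_zero.2 (hprim.pow_ne_one_of_pos_of_lt (by omega) hk'.2).symm
  obtain ⟨M, rfl⟩ := Nat.exists_eq_succ_of_ne_zero hN
  -- The factor l = N-1 has base 1 - ω^N = 0 but exponent 0, so it equals 1.
  rw [hD, Finset.prod_range_succ, Nat.succ_eq_add_one, Nat.add_sub_cancel, Nat.sub_self, pow_zero,
    mul_one, ← Finset.prod_mul_distrib]
  have h := hprim.prod_one_sub_pow_eq_order
  push_cast
  rw [← h, ← Finset.prod_pow]
  refine Finset.prod_congr rfl fun l hl => ?_
  have := Finset.mem_range.1 hl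
  rw [← pow_add]
  congr 1
  omega

lemma bigD_ne_zero (N : ℕ) (ζ : ℂ) : bigD N ζ ≠ 0 := exp_ne_zero _

/-! ### The determinant of the operator -/

lemma det_circulantOp (ε : ℝ) (N : ℕ) (ζ₀ ζ₁ : ℂ) (v : Module.Basis (Fin N) ℂ (Fin N → ℂ)) :
    LinearMap.det (circulantOp ε N ζ₀ ζ₁ v) =
      (Matrix.of fun i j : Fin N => cyclicLambda ε N ζ₀ ζ₁ ((i : ℤ) - (j : ℤ))).det := by
  rw [← LinearMap.det_toMatrix v]
  congr 1
  ext i j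
  rw [LinearMap.toMatrix_apply, circulantOp, Module.Basis.constr_basis, map_sum, Finset.sum_apply']
  simp [Finsupp.single_apply]

/-- Exactly N-1-i steps of the functional equation lead from ζ⁰+i-j to ζ⁰+N-1-j, which no longer
depends on the row. -/
lemma cyclicLambda_eq {ε : ℝ} (hε : 0 < ε) {N : ℕ} (hN : N ≠ 0)
    (hε' : ε < Real.pi / Real.sqrt N) {ζ₀ : ℂ} (hζ : 1 - exp (2 * Real.pi * I * ζ₀) ≠ 0)
    (ζ₁ : ℂ) (i j : Fin N) :
    cyclicLambda ε N ζ₀ ζ₁ ((i : ℤ) - (j : ℤ)) =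
      (omegaPow N (-(ζ₀ * ζ₁) / 2) * (omegaPow N ζ₁ ^ (i : ℕ))⁻¹) *
        ((omegaPow N ζ₁ ^ (j : ℕ) * dilogProd N (ζ₀ + (N - 1 - j : ℕ))) *
          ∏ l ∈ Finset.range (N - 1 - i),
            (1 - omegaPow N 1 ^ ((i : ℕ) + 1 + l) * omegaPow N ζ₀ *
              (omegaPow N 1 ^ (j : ℕ))⁻¹)) := by
  have hi := i.2
  have hj := j.2
  rw [cyclicLambda, phiN_eq_dilogProd hN hε hε' (by rwa [exp_two_pi_I_mul_add_int]),
    dilogProd_add_natCast hN hζ _ (N - 1 - i)]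
  have e1 : omegaPow N (-((((i : ℤ) - (j : ℤ) : ℤ) : ℂ) * ζ₁)) =
      (omegaPow N ζ₁ ^ (i : ℕ))⁻¹ * omegaPow N ζ₁ ^ (j : ℕ) := by
    rw [eq_inv_mul_iff_mul_eq₀ (pow_ne_zero _ (omegaPow_ne_zero N ζ₁)), ← omegaPow_natCast_mul,
      ← omegaPow_natCast_mul, ← omegaPow_add]
    congr 1
    push_cast
    ring
  have e2 : ζ₀ + (((i : ℤ) - (j : ℤ) : ℤ) : ℂ) + ((N - 1 - i : ℕ) : ℂ) =
      ζ₀ + ((N - 1 - j : ℕ) : ℂ) := by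
    rw [Nat.cast_sub (by omega), Nat.cast_sub (by omega : (j : ℕ) ≤ N - 1)]
    push_cast
    ring
  have e3 : ∀ l : ℕ, omegaPow N (ζ₀ + (((i : ℤ) - (j : ℤ) : ℤ) : ℂ) + 1 + l) =
      omegaPow N 1 ^ ((i : ℕ) + 1 + l) * omegaPow N ζ₀ * (omegaPow N 1 ^ (j : ℕ))⁻¹ := by
    intro l
    rw [eq_mul_inv_iff_mul_eq₀ (pow_ne_zero _ (omegaPow_ne_zero N 1)), ← omegaPow_natCast,
      ← omegaPow_natCast, ← omegaPow_add, ← omegaPow_add]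
    congr 1
    push_cast
    ring
  rw [e1, e2]
  simp only [e3]
  ring

lemma det_cyclicLambda {ε : ℝ} (hε : 0 < ε) {N : ℕ} (hN : N ≠ 0)
    (hε' : ε < Real.pi / Real.sqrt N) {ζ₀ : ℂ} (hζ : 1 - exp (2 * Real.pi * I * ζ₀) ≠ 0)
    (ζ₁ : ℂ) :
    (Matrix.of fun i j : Fin N => cyclicLambda ε N ζ₀ ζ₁ ((i : ℤ) - (j : ℤ))).det =
      omegaPow N (-(ζ₀ * ζ₁) / 2) ^ N * dilogExp ζ₀ *
        (omegaPow N ζ₀ ^ (∑ i ∈ Finset.range N, i) *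
          ∏ l ∈ Finset.range N, (1 - omegaPow N 1 ^ (l + 1)) ^ (N - 1 - l)) := by
  rw [← det_prod_one_sub_pow N (omegaPow_ne_zero N 1) (omegaPow_ne_zero N ζ₀)]
  simp only [cyclicLambda_eq hε hN hε' hζ ζ₁]
  set A : Matrix (Fin N) (Fin N) ℂ := Matrix.of fun i j => ∏ l ∈ Finset.range (N - 1 - i),
    (1 - omegaPow N 1 ^ ((i : ℕ) + 1 + l) * omegaPow N ζ₀ * (omegaPow N 1 ^ (j : ℕ))⁻¹) with hA
  have h1 := Matrix.det_mul_column
    (fun i : Fin N => omegaPow N (-(ζ₀ * ζ₁) / 2) * (omegaPow N ζ₁ ^ (i : ℕ))⁻¹)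
    (Matrix.of fun i j : Fin N =>
      (omegaPow N ζ₁ ^ (j : ℕ) * dilogProd N (ζ₀ + (N - 1 - j : ℕ))) * A i j)
  have h2 := Matrix.det_mul_row
    (fun j : Fin N => omegaPow N ζ₁ ^ (j : ℕ) * dilogProd N (ζ₀ + (N - 1 - j : ℕ))) A
  rw [h2] at h1
  refine h1.trans ?_
  rw [← mul_assoc]
  congr 1
  have hd : ∏ j : Fin N, dilogProd N (ζ₀ + (N - 1 - j : ℕ)) = dilogExp ζ₀ := by
    rw [Fin.prod_univ_eq_prod_range (fun j => dilogProd N (ζ₀ + (N - 1 - j : ℕ))) N,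
      Finset.prod_range_reflect (fun j => dilogProd N (ζ₀ + j)) N, prod_dilogProd hN hζ]
  have hne : ∏ i : Fin N, omegaPow N ζ₁ ^ (i : ℕ) ≠ 0 :=
    Finset.prod_ne_zero_iff.2 fun i _ => pow_ne_zero _ (omegaPow_ne_zero N ζ₁)
  rw [Finset.prod_mul_distrib, Finset.prod_mul_distrib, hd, Finset.prod_inv_distrib,
    Finset.prod_const, Finset.card_univ, Fintype.card_fin]
  field_simp

end QuantumDilog

theorem mainTheorem9 (N : ℕ) (hN : 2 ≤ N)
    (ε : ℝ) (hε : 0 < ε) (hε' : ε < Real.pi / Real.sqrt N)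
    (ζ₀ ζ₁ : ℂ)
    (hζ : Complex.exp (2 * Real.pi * Complex.I * ζ₁) =
      1 / (1 - Complex.exp (2 * Real.pi * Complex.I * ζ₀)))
    (v : Module.Basis (Fin N) ℂ (Fin N → ℂ)) :
    LinearMap.det (QuantumDilog.circulantOp ε N ζ₀ ζ₁ v) =
      (N : ℂ) ^ N / QuantumDilog.bigD N 0 ^ N *
        QuantumDilog.omegaPow N ((N : ℂ) * ((N : ℂ) - 1) * ζ₀ / 2) *
        Complex.exp (-(QuantumDilog.liftedDilog ζ₀ ζ₁ / (2 * Real.pi * Complex.I))) := by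
  have hN0 : N ≠ 0 := by omega
  have hN' : (N : ℂ) ≠ 0 := Nat.cast_ne_zero.2 hN0
  -- With the convention 1/0 = 0, a vanishing denominator would force e^{2πiζ¹} = 0.
  have hζ₀ : 1 - Complex.exp (2 * Real.pi * Complex.I * ζ₀) ≠ 0 := fun h => by
    rw [h, div_zero] at hζ
    exact Complex.exp_ne_zero _ hζ
  have hpi : (2 * Real.pi * Complex.I : ℂ) ≠ 0 := Complex.two_pi_I_ne_zero
  have hsum : ((∑ i ∈ Finset.range N, i : ℕ) : ℂ) = (N : ℂ) * ((N : ℂ) - 1) / 2 := by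
    have h := congrArg (fun n : ℕ => (n : ℂ)) (Finset.sum_range_id_mul_two N)
    simp only [Nat.cast_mul] at h
    rw [Nat.cast_sub (by omega)] at h
    rw [eq_div_iff two_ne_zero]
    exact_mod_cast h
  have hpow : QuantumDilog.omegaPow N ζ₀ ^ (∑ i ∈ Finset.range N, i) =
      QuantumDilog.omegaPow N ((N : ℂ) * ((N : ℂ) - 1) * ζ₀ / 2) := by
    rw [← QuantumDilog.omegaPow_natCast_mul, hsum]
    congr 1
    ring
  have hexp : QuantumDilog.omegaPow N (-(ζ₀ * ζ₁) / 2) ^ N * QuantumDilog.dilogExp ζ₀ =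
      Complex.exp (-(QuantumDilog.liftedDilog ζ₀ ζ₁ / (2 * Real.pi * Complex.I))) := by
    rw [← QuantumDilog.omegaPow_natCast_mul, QuantumDilog.omegaPow, QuantumDilog.dilogExp,
      ← Complex.exp_add, QuantumDilog.dilogLog, QuantumDilog.liftedDilog]
    congr 1
    generalize (2 * Real.pi * Complex.I : ℂ) = c at hpi
    field_simp
    ring
  rw [QuantumDilog.det_circulantOp, QuantumDilog.det_cyclicLambda hε hN0 hε' hζ₀, hexp, hpow,
    eq_div_of_mul_eq (pow_ne_zero N (QuantumDilog.bigD_ne_zero N 0))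
      (QuantumDilog.prod_one_sub_omegaPow_mul_bigD hN0)]
  ring
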